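/- **Circuits.** Fix an integer $q\ge 2$ and a polynomial $p$ with natural-number coefficients. A *QACC family* (with modulus $q$) consists, for each $n\ge 0$, of layers $U_1,\dots,U_t$ (with $t=t(n)$ bounded independently of $n$) acting on $N=n+p(n)$ qubits (lines). Each layer is either * a Kronecker product of gates acting on consecutive blocks of lines (with no reordering of lines), each gate being a one-qubit gate from a finite subset of $U(2)$ that does not depend on $n$, a Toffoli gate $|x_1,\dots,x_m,y\rangle\mapsto|x_1,\dots,x_m,y\oplus(x_1\wedge\dots\wedge x_m)\rangle$, a fan-out gate $|y_1,\dots,y_m,x\rangle\mapsto|x\oplus y_1,\dots,x\oplus y_m,x\rangle$, or a gate $\mathrm{MOD}_{q,r}:|y_1,\dots,y_m,x\rangle\mapsto|y_1,\dots,y_m,x\oplus[\sum_i y_i\equiv r \bmod q]\rangle$; or * a *controlled-not layer*, which performs in one step controlled-nots on an arbitrary collection of disjoint ordered pairs of lines. The family is in *fan-out form* if no $\mathrm{MOD}$ gates occur. It is in $\mathrm{QACC}^{\log}_{pl}$ if each of its controlled-not layers is a composition of $O(\log n)$ operators, each a Kronecker product of identities and spaced controlled-nots (a controlled-not between the first and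 the last line of a block of consecutive lines, in either direction). It is in $\mathrm{QACC}^{\log}_{gates}$ if the total number of multi-line gates in all layers is $O(\log n)$, the controlled-nots of a controlled-not layer being counted individually. (Here and below $O(\log n)$ means at most $C(\lfloor\log_2 n\rfloor+1)$ for all $n$, with $C$ independent of $n$ and $\lfloor\log_2 0\rfloor:=0$.) **Tensor graphs.** A *tensor graph* for $N$ lines is a finite directed acyclic graph with exactly one node of indegree zero (the source) and exactly one node of outdegree zero (the terminal), and with two kinds of edges: unlabelled *horizontal* edges, and *vertical* edges labelled by a pair of complex amplitudes and a product of colors and anticolors (possibly $1$). Every path from source to terminal traverses exactly $N$ vertical edges, and each node has at most one incoming and at most one outgoing vertical edge. The *height* of a node is the number of vertical edges on any path to it from the source; the height of an edge is that of its end node. The *width* is the maximum number of nodes of the same height, the *size* is the number of nodes and edges. A color $c$ and its anticolor $\tilde c$ satisfy $c\cdot c=\tilde c\cdot\tilde c=1$ and $c\cdot\tilde c=0$; different colors commute and multiply freely, and products are taken in the resulting commutative nonassociative $\mathbb C$-algebra. The amplitude of $|x_1,\dots,x_N\rangle$ in a path from source to terminal is the product over $k=1,\dots,N$, in order, of the color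 product of the vertical edge of height $k$ times its left (if $x_k=0$) or right (if $x_k=1$) amplitude; its amplitude in the graph is the sum of its amplitudes in all such paths. The graph *represents* a vector $\psi\in(\mathbb C^2)^{\otimes N}$ if for every $x$ the amplitude of $|x\rangle$ in it is the scalar $\langle x|\psi\rangle$. A family of tensor graphs is *color-consistent* if (a) the number of colors at each height is bounded by a constant; (b) each color and its anticolor appear at exactly two heights, the same ones for both; (c) the color products of the edges of one height all involve the same colors, each entering as itself or as its anticolor. A color is *active* at a height that is at or after its first occurrence and below its second one; the family has *log-color depth* if the number of active colors at each height is $O(\log n)$. **Theorem.** Given a QACC family as above and a family of product states $|\vec z_n\rangle=|z_{n,1}\rangle\otimes\dots\otimes|z_{n,N}\rangle$ with $z_{n,i}\in\mathbb C^2$ (for instance computational basis states), there is a family of tensor graphs $\{G_n\}$ such that: 1. $\{G_n\}$ is color-consistent; $G_n$ has width at most $q^{2^{2t}}$, and width at most $2^{2^{2t}}$ if the QACC family is in fan-out form; the size of $G_n$ is at most polynomial in $n$; and $G_n$ represents the vector $U_1\cdots U_t|\vec z_n\rangle$. 2. If the QACC family is in $\mathrm{QACC}^{\log}_{pl}$,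 then $\{G_n\}$ has log-color depth. 3. If the QACC family is in $\mathrm{QACC}^{\log}_{gates}$, then the number of paths from the source to the terminal of $G_n$ is bounded by a polynomial in $n$. -/

import Mathlib

open scoped Polynomial

noncomputable section

/-! ### Qubits, gates and layers -/

/-- Labels of the computational basis of `N` qubits. Addition in `Fin 2` is exclusive or. -/
abbrev Bits (N : ℕ) : Type := Fin N → Fin 2

/-- Operators on `N` qubits, written in the computational basis: `A x y` is `⟨x|A|y⟩`. -/
abbrev QOp (N : ℕ) : Type := Matrix (Bits N) (Bits N) ℂ

/-- The operator `|y⟩ ↦ |f y⟩`. -/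
def basisMap {N : ℕ} (f : Bits N → Bits N) : QOp N := fun x y => if x = f y then 1 else 0

/-- The gates, indexed by the number of lines on which they act. -/
inductive Gate : ℕ → Type
  /-- An arbitrary element of `U(2)`. -/
  | oneQubit (U : Matrix.unitaryGroup (Fin 2) ℂ) : Gate 1
  /-- `|x₁, …, x_m, y⟩ ↦ |x₁, …, x_m, y ⊕ (x₁ ∧ ⋯ ∧ x_m)⟩` -/
  | toffoli (m : ℕ) : Gate (m + 1)
  /-- `|y₁, …, y_m, x⟩ ↦ |x ⊕ y₁, …, x ⊕ y_m, x⟩` -/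
  | fanOut (m : ℕ) : Gate (m + 1)
  /-- `|y₁, …, y_m, x⟩ ↦ |y₁, …, y_m, x ⊕ [y₁ + ⋯ + y_m ≡ r mod q]⟩` -/
  | modGate (q r m : ℕ) : Gate (m + 1)

namespace Gate

/-- The operator performed by a gate. -/
def toOp : {a : ℕ} → Gate a → QOp a
  | _, oneQubit U => fun x y => (U : Matrix (Fin 2) (Fin 2) ℂ) (x 0) (y 0)
  | _, toffoli m => basisMap fun y =>
      Function.update y (Fin.last m)
        (y (Fin.last m) + if ∀ i : Fin m, y i.castSucc = 1 then 1 else 0)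
  | _, fanOut m => basisMap fun y i =>
      if i = Fin.last m then y i else y (Fin.last m) + y i
  | _, modGate q r m => basisMap fun y =>
      Function.update y (Fin.last m)
        (y (Fin.last m) + if (∑ i : Fin m, (y i.castSucc : ℕ)) ≡ r [MOD q] then 1 else 0)

/-- The one-qubit gates come from `S` and the modular gates have modulus `q`. -/
def Allowed (q : ℕ) (S : Set (Matrix.unitaryGroup (Fin 2) ℂ)) : {a : ℕ} → Gate a → Prop
  | _, oneQubit U => U ∈ S
  | _, toffoli _ => True
  | _, fanOut _ => True
  | _, modGate q' _ _ => q' = q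

/-- The gate is not a modular gate. -/
def NotMod : {a : ℕ} → Gate a → Prop
  | _, modGate _ _ _ => False
  | _, _ => True

end Gate

/-- The Kronecker product of operators on consecutive blocks of lines; the lines are cut into
blocks by a composition of `N`, and no reordering of the lines takes place. -/
def kron {N : ℕ} (c : Composition N) (M : (i : Fin c.length) → QOp (c.blocksFun i)) : QOp N :=
  fun x y => ∏ i, M i (x ∘ c.embedding i) (y ∘ c.embedding i)

/-- A collection of disjoint ordered pairs (control, target) of lines: `ctrl j = some i` says that
`(i, j)` is one of the pairs. -/
structure CNotLayer (N : ℕ) where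
  ctrl : Fin N → Option (Fin N)
  /-- A control is not a target (of its own pair or of another one). -/
  ctrl_not_target : ∀ i j, ctrl j = some i → ctrl i = none
  /-- A line is the control of at most one pair. -/
  ctrl_inj : ∀ i j j', ctrl j = some i → ctrl j' = some i → j = j'

/-- The controlled-not's of all pairs, performed in one step. -/
def CNotLayer.toOp {N : ℕ} (P : CNotLayer N) : QOp N :=
  basisMap fun y j => match P.ctrl j with
    | some i => y j + y i
    | none => y j

/-- A layer: a Kronecker product of gates, or a controlled-not layer. -/
inductive Layer (N : ℕ) : Type
  | tensor (c : Composition N) (g : (i : Fin c.length) → Gate (c.blocksFun i)) : Layer N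
  | cnot (P : CNotLayer N) : Layer N

namespace Layer

variable {N : ℕ}

/-- The operator performed by a layer. -/
def toOp : Layer N → QOp N
  | tensor c g => kron c fun i => (g i).toOp
  | cnot P => P.toOp

/-- All gates of the layer are allowed. -/
def Allowed (q : ℕ) (S : Set (Matrix.unitaryGroup (Fin 2) ℂ)) : Layer N → Prop
  | tensor _ g => ∀ i, (g i).Allowed q S
  | cnot _ => True

/-- The layer has no modular gate. -/
def NotMod : Layer N → Prop
  | tensor _ g => ∀ i, (g i).NotMod
  | cnot _ => True

/-- The number of gates of the layer that act on more than one line; the controlled-not's of a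
controlled-not layer are counted one by one. -/
def multiLine : Layer N → ℕ
  | tensor c _ => (Finset.univ.filter fun i => 1 < c.blocksFun i).card
  | cnot P => (Finset.univ.filter fun j => P.ctrl j ≠ none).card

end Layer

/-- The identity on one line and the spaced controlled-not gates. -/
inductive SpacedGate : ℕ → Type
  | ident : SpacedGate 1
  /-- The last of `m + 2` consecutive lines controls the first one. -/
  | up (m : ℕ) : SpacedGate (m + 2)
  /-- The first of `m + 2` consecutive lines controls the last one. -/
  | down (m : ℕ) : SpacedGate (m + 2)

/-- The operator performed by a spaced gate. -/
def SpacedGate.toOp : {a : ℕ} → SpacedGate a → QOp a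
  | _, ident => 1
  | _, up m => basisMap fun y => Function.update y 0 (y 0 + y (Fin.last (m + 1)))
  | _, down m => basisMap fun y =>
      Function.update y (Fin.last (m + 1)) (y (Fin.last (m + 1)) + y 0)

/-- The operator is a Kronecker product of identities and spaced controlled-not gates. -/
def IsSpacedProduct {N : ℕ} (A : QOp N) : Prop :=
  ∃ (c : Composition N) (g : (i : Fin c.length) → SpacedGate (c.blocksFun i)),
    A = kron c fun i => (g i).toOp

/-- The operator is a composition of at most `d` Kronecker products of identities and spaced
controlled-not gates. -/
def HasSpacedDepth {N : ℕ} (d : ℕ) (A : QOp N) : Prop :=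
  ∃ L : List (QOp N), L.length ≤ d ∧ (∀ B ∈ L, IsSpacedProduct B) ∧ L.prod = A

/-! ### Families of circuits -/

/-- A family of layered circuits; the `n`-th one acts on `n + p(n)` lines, with `p` a polynomial. -/
structure CircuitFamily where
  p : ℕ[X]
  layers : (n : ℕ) → List (Layer (n + p.eval n))

namespace CircuitFamily

variable (F : CircuitFamily)

/-- The number of lines of the `n`-th circuit. -/
abbrev lines (n : ℕ) : ℕ := n + F.p.eval n

/-- The number of layers of the `n`-th circuit. -/
def depth (n : ℕ) : ℕ := (F.layers n).length

/-- The operator `U₁ ⋯ U_t`, the layers of the `n`-th circuit being `U₁, …, U_t`. -/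
def toOp (n : ℕ) : QOp (F.lines n) := ((F.layers n).map Layer.toOp).prod

/-- QACC families with modulus `q`: boundedly many layers, a fixed finite set of one-qubit gates,
Toffoli gates, fan-out gates, modular gates of modulus `q`, and controlled-not layers. -/
def IsQACC (q : ℕ) : Prop :=
  (∃ T : ℕ, ∀ n, F.depth n ≤ T) ∧
  ∃ S : Set (Matrix.unitaryGroup (Fin 2) ℂ), S.Finite ∧ ∀ n, ∀ U ∈ F.layers n, U.Allowed q S

/-- No modular gates occur: the multi-line gates of the tensor layers are Toffoli and fan-out
gates. -/
def FanOutForm : Prop := ∀ n, ∀ U ∈ F.layers n, U.NotMod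

/-- All controlled-not layers are log-depth. -/
def LogPlanar : Prop :=
  ∃ C : ℕ, ∀ n, ∀ P : CNotLayer (F.lines n), Layer.cnot P ∈ F.layers n →
    HasSpacedDepth (C * (Nat.log 2 n + 1)) P.toOp

/-- The total number of multi-line gates in all layers is log-bounded. -/
def LogGates : Prop :=
  ∃ C : ℕ, ∀ n, ((F.layers n).map Layer.multiLine).sum ≤ C * (Nat.log 2 n + 1)

end CircuitFamily

/-- The coordinates of the product state `|z₁, …, z_N⟩`; the basis states are the case in which
every `z i` is `Pi.single 0 1` or `Pi.single 1 1`. -/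
def productState {N : ℕ} (z : Fin N → Fin 2 → ℂ) : Bits N → ℂ := fun y => ∏ i, z i (y i)

/-! ### The algebra of colors -/

/-- A reduced product of colors and anticolors from the palette `κ`: the color `c` is a factor if
`m c = some true`, its anticolor is a factor if `m c = some false`, neither is if `m c = none`. -/
abbrev ColorMonomial (κ : Type) : Type := κ → Option Bool

open Classical in
/-- The product of two monomials: `none` is zero. It multiplies color by color, with
`c · c = c̃ · c̃ = 1` and `c · c̃ = c̃ · c = 0`. -/
def ColorMonomial.mul {κ : Type} (a b : ColorMonomial κ) : Option (ColorMonomial κ) :=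
  if ∃ c u, a c = some u ∧ b c = some (!u) then none
  else some fun c => match a c, b c with
    | none, v => v
    | u, none => u
    | some _, some _ => none

/-- The (nonassociative) `ℂ`-algebra of colors: finite formal sums of complex multiples of
monomials. -/
def ColorAlgebra (κ : Type) : Type := ColorMonomial κ →₀ ℂ

namespace ColorAlgebra

variable {κ : Type}

instance : AddCommGroup (ColorAlgebra κ) := inferInstanceAs (AddCommGroup (ColorMonomial κ →₀ ℂ))

instance : Module ℂ (ColorAlgebra κ) := inferInstanceAs (Module ℂ (ColorMonomial κ →₀ ℂ))

/-- A complex multiple of a monomial. -/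
def term (m : ColorMonomial κ) (a : ℂ) : ColorAlgebra κ := Finsupp.single m a

/-- A complex number as an element of the algebra. -/
def scalar (a : ℂ) : ColorAlgebra κ := term (fun _ => none) a

instance : One (ColorAlgebra κ) := ⟨scalar 1⟩

/-- The bilinear extension of the product of monomials. -/
instance : Mul (ColorAlgebra κ) :=
  ⟨fun f g => Finsupp.sum f fun m a => Finsupp.sum g fun m' b =>
    match m.mul m' with
    | some l => term l (a * b)
    | none => 0⟩

theorem term_mul_term (m m' : ColorMonomial κ) (a b : ℂ) :
    term m a * term m' b =
      (match m.mul m' with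
        | some l => term l (a * b)
        | none => 0 : ColorAlgebra κ) := by
  have hz : ∀ l : ColorMonomial κ, term l (0 : ℂ) = (0 : ColorAlgebra κ) :=
    fun l => Finsupp.single_zero l
  refine (Finsupp.sum_single_index ?_).trans (Finsupp.sum_single_index ?_)
  · refine Finset.sum_eq_zero fun l _ => ?_
    dsimp only
    split
    · rw [zero_mul, hz]
    · rfl
  · split
    · rw [mul_zero, hz]
    · rfl

end ColorAlgebra

/-! ### Tensor graphs -/

/-- A tensor graph for `N` lines. Vertical edges carry a pair of amplitudes and a product of colors
and anticolors. The `height` of a node is the number of vertical edges on any path to it from the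
source; a vertical edge of level `i : Fin N` (counted from zero) joins height `i` to height `i + 1`
and belongs to line `i`. -/
structure TensorGraph (N : ℕ) where
  V : Type
  /-- Horizontal edges. -/
  H : Type
  /-- Vertical edges. -/
  E : Type
  /-- The palette of colors. -/
  Color : Type
  [finV : Fintype V]
  [finH : Fintype H]
  [finE : Fintype E]
  [finColor : Fintype Color]
  hsrc : H → V
  htgt : H → V
  vsrc : E → V
  vtgt : E → V
  source : V
  terminal : V
  height : V → Fin (N + 1)
  level : E → Fin N
  amp : E → Fin 2 → ℂ
  color : E → ColorMonomial Color
  /-- There are no parallel horizontal edges. -/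
  h_simple : Function.Injective fun e => (hsrc e, htgt e)
  /-- Vertical outdegrees are at most one. -/
  vsrc_inj : Function.Injective vsrc
  /-- Vertical indegrees are at most one. -/
  vtgt_inj : Function.Injective vtgt
  height_source : height source = 0
  height_terminal : height terminal = Fin.last N
  height_h : ∀ e, height (htgt e) = height (hsrc e)
  height_vsrc : ∀ e, height (vsrc e) = (level e).castSucc
  height_vtgt : ∀ e, height (vtgt e) = (level e).succ
  /-- There are no directed cycles. -/
  acyclic : ∀ v, ¬ Relation.TransGen
    (fun u w => (∃ e, hsrc e = u ∧ htgt e = w) ∨ ∃ e, vsrc e = u ∧ vtgt e = w) v v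
  /-- The source is the only node of indegree zero. -/
  source_iff : ∀ v, ((∀ e, htgt e ≠ v) ∧ ∀ e, vtgt e ≠ v) ↔ v = source
  /-- The terminal is the only node of outdegree zero. -/
  terminal_iff : ∀ v, ((∀ e, hsrc e ≠ v) ∧ ∀ e, vsrc e ≠ v) ↔ v = terminal

namespace TensorGraph

attribute [instance] TensorGraph.finV TensorGraph.finH TensorGraph.finE TensorGraph.finColor

variable {N : ℕ} (G : TensorGraph N)

/-- The origin of an edge. -/
def src : G.H ⊕ G.E → G.V := Sum.elim G.hsrc G.vsrc

/-- The end of an edge. -/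
def tgt : G.H ⊕ G.E → G.V := Sum.elim G.htgt G.vtgt

/-- The list of edges leads from `u` to `v`. -/
def Leads : G.V → List (G.H ⊕ G.E) → G.V → Prop
  | u, [], v => u = v
  | u, e :: l, v => G.src e = u ∧ Leads (G.tgt e) l v

open Classical in
/-- The paths from the source to the terminal, as lists of edges. (In an acyclic graph no edge is
traversed twice.) -/
def paths : Finset {l : List (G.H ⊕ G.E) // l.Nodup} :=
  Finset.univ.filter fun l => G.Leads G.source l.1 G.terminal

/-- The amplitude of `|x_i⟩` in a vertical edge of line `i`. -/
def edgeAmp (x : Bits N) (e : G.E) : ColorAlgebra G.Color :=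
  ColorAlgebra.term (G.color e) (G.amp e (x (G.level e)))

/-- The amplitude of `|x⟩` in a path: the product of its amplitudes in the vertical edges of the
path, taken from the source to the terminal. -/
def pathAmp (x : Bits N) (l : List (G.H ⊕ G.E)) : ColorAlgebra G.Color :=
  ((l.filterMap Sum.getRight?).map (G.edgeAmp x)).foldl (fun a b => a * b) 1

/-- The amplitude of `|x⟩` in the tensor graph. -/
def amplitude (x : Bits N) : ColorAlgebra G.Color := ∑ l ∈ G.paths, G.pathAmp x l.1

/-- The tensor graph represents the vector with coordinates `ψ`. -/
def Represents (ψ : Bits N → ℂ) : Prop := ∀ x, G.amplitude x = ColorAlgebra.scalar (ψ x)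

open Classical in
/-- The maximum number of nodes of the same height. -/
def width : ℕ :=
  Finset.univ.sup fun h : Fin (N + 1) => (Finset.univ.filter fun v => G.height v = h).card

/-- The number of nodes and edges. -/
def size : ℕ := Fintype.card G.V + Fintype.card G.H + Fintype.card G.E

/-- The color `c` (for `s = true`) or its anticolor (for `s = false`) appears in a vertical edge of
level `i`. -/
def Appears (c : G.Color) (s : Bool) (i : Fin N) : Prop :=
  ∃ e, G.level e = i ∧ G.color e c = some s

/-- `i < j` are exactly the two levels of the color `c`, and of its anticolor. -/
def ColorLevels (c : G.Color) (i j : Fin N) : Prop :=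
  i < j ∧ ∀ (s : Bool) (l : Fin N), G.Appears c s l ↔ l = i ∨ l = j

open Classical in
/-- The number of colors at a level. -/
def colorsAt (i : Fin N) : ℕ := (Finset.univ.filter fun c => ∃ s, G.Appears c s i).card

open Classical in
/-- The number of colors that are active at a level: the level is at or after the first occurrence
and before the second one. -/
def activeAt (l : Fin N) : ℕ :=
  (Finset.univ.filter fun c => ∃ i j, G.ColorLevels c i j ∧ i ≤ l ∧ l < j).card

end TensorGraph

/-- Color consistency of a family: (1) boundedly many colors at each height; (2) each color and its
anticolor appear at exactly two heights, the same ones for both; (3) all color products of a height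
are products over the same colors, each entering as itself or as its anticolor. -/
def ColorConsistent {N : ℕ → ℕ} (G : (n : ℕ) → TensorGraph (N n)) : Prop :=
  (∃ k : ℕ, ∀ n i, (G n).colorsAt i ≤ k) ∧
  (∀ n c, ∃ i j, (G n).ColorLevels c i j) ∧
  ∀ n e e', (G n).level e = (G n).level e' →
    ∀ c, (G n).color e c = none ↔ (G n).color e' c = none

/-- The number of active colors at each height is log-bounded. -/
def LogColorDepth {N : ℕ → ℕ} (G : (n : ℕ) → TensorGraph (N n)) : Prop :=
  ∃ C : ℕ, ∀ n l, (G n).activeAt l ≤ C * (Nat.log 2 n + 1)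

end

noncomputable section

/-! Every layer is a sum of Kronecker products of one-qubit operators, indexed by the choice of one
of `d = e + 2` indices on each line, subject to equality constraints. In a tensor layer the Toffoli
and fan-out gates have tensor rank at most 2 and a modular gate has rank at most `q` by Fourier
analysis on `ℤ/q`; the index must be constant on each block, which is a condition on neighbouring
lines only. In a controlled-not layer the index of a control is its bit, the target receives the
corresponding power of `X`, and the constraint equates the indices of two lines that may be far
apart.

Multiplying `t` layers and applying the result to a product state gives a sum, over choices of `t`
indices per line, of products of one factor per line (`KronSum.prod_mulVec`). The graph has one
vertical edge for each line and each admissible `t`-tuple of indices. Horizontal edges enforce the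
constraints between neighbours, and one color per controlled-not enforces the distant ones: the two
ends of a pair contribute `c · c` or `c̃ · c̃` if the indices agree, and `c · c̃ = 0` otherwise.
Each color occurs on exactly two lines, so the nonassociativity of the algebra does no harm
(`ColorAlgebra.foldl_term`). A height has at most `2 * d ^ t` nodes.

The active colors at a level are the controlled-nots across a cut. A Kronecker product of spaced
controlled-nots has at most one gate across a given cut, so as an `𝔽₂`-linear map it carries at most
one bit in each direction; `m` controlled-nots of disjoint pairs carry `m` bits in their direction.
Hence spaced depth `D` allows at most `2 * D` crossings (`CNotLayer.card_crossing_le`).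

Paths correspond to choices satisfying the neighbour constraints. Only multi-line gates leave
freedom, at most `d ^ 2` for each, and `d` to a logarithmic power is polynomial. -/

/-- The sequence `z, a 0, …, a (N - 1), z, z, …`. -/
def extend {α : Type*} {N : ℕ} (a : Fin N → α) (z : α) : ℕ → α
  | 0 => z
  | h + 1 => if hh : h < N then a ⟨h, hh⟩ else z

section extend

variable {α : Type*} {N : ℕ} (a : Fin N → α) (z : α)

@[simp] theorem extend_zero : extend a z 0 = z := rfl

@[simp] theorem extend_succ (i : Fin N) : extend a z (i + 1) = a i := by
  simp [extend]

theorem extend_of_lt {h : ℕ} (hh : N < h) : extend a z h = z := by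
  cases h with
  | zero => rfl
  | succ h => simp [extend, show ¬ h < N by omega]

theorem eq_extend (b : ℕ → α) (h0 : b 0 = z) (hN : b (N + 1) = z) {h : ℕ} (hh : h ≤ N + 1) :
    extend (fun i : Fin N => b (i + 1)) z h = b h := by
  cases h with
  | zero => simp [h0]
  | succ h =>
    rcases Nat.lt_or_ge h N with h1 | h1
    · simp [extend, h1]
    · obtain rfl : h = N := by omega
      simp [extend, hN]

theorem forall_extend {P : ℕ → α → Prop} :
    (∀ h, P h (extend a z h)) ↔
      (∀ i : Fin N, P (i + 1) (a i)) ∧ P 0 z ∧ ∀ h, N < h → P h z := by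
  constructor
  · intro H
    exact ⟨fun i => by simpa using H (i + 1), by simpa using H 0,
      fun h hh => by simpa [extend_of_lt a z hh] using H h⟩
  · rintro ⟨h1, h2, h3⟩ h
    cases h with
    | zero => exact h2
    | succ h =>
      by_cases hh : h < N
      · simpa [extend, hh] using h1 ⟨h, hh⟩
      · simpa [extend, hh] using h3 (h + 1) (by omega)

end extend

/-! ### Networks and their tensor graphs -/

/-- A presentation of a tensor graph whose vertical edges of line `i` are the states `κ` with
`ok (i + 1) κ`. Positions `0` and `N + 1` carry the single state `base`; the relation `rel h` tells
which states at position `h` and `h + 1` are joined by a horizontal edge. -/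
structure Network (N : ℕ) where
  K : Type
  Color : Type
  [finK : Fintype K]
  [finColor : Fintype Color]
  base : K
  ok : ℕ → K → Prop
  rel : ℕ → K → K → Prop
  amp : Fin N → K → Fin 2 → ℂ
  color : Fin N → K → ColorMonomial Color
  ok_zero : ∀ κ, ok 0 κ ↔ κ = base
  ok_last : ∀ κ, ok (N + 1) κ ↔ κ = base
  exists_pred : ∀ h κ, ok (h + 1) κ → ∃ κ', ok h κ' ∧ rel h κ' κ
  exists_succ : ∀ h κ, ok h κ → ∃ κ', ok (h + 1) κ' ∧ rel h κ κ'

namespace Network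

attribute [instance] Network.finK Network.finColor

variable {N : ℕ} (D : Network N)

/-- Nodes: `(h, false, κ)` is the end of an edge at position `h`, and `(h, true, κ)` is the origin
of an edge at position `h + 1`. -/
abbrev Node : Type := {v : Fin (N + 1) × Bool × D.K // D.ok (v.1 + v.2.1.toNat) v.2.2}

/-- Horizontal edges. -/
abbrev HEdge : Type :=
  {e : Fin (N + 1) × D.K × D.K // D.ok e.1 e.2.1 ∧ D.ok (e.1 + 1) e.2.2 ∧ D.rel e.1 e.2.1 e.2.2}

/-- Vertical edges. -/
abbrev VEdge : Type := {e : Fin N × D.K // D.ok (e.1 + 1) e.2}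

/-- Increases along all edges. -/
def rank (v : D.Node) : ℕ := 2 * v.1.1 + v.1.2.1.toNat

theorem rank_lt_of_transGen {V : Type*} {r : V → V → Prop} (f : V → ℕ)
    (h : ∀ u w, r u w → f u < f w) {u w : V} (huw : Relation.TransGen r u w) : f u < f w := by
  induction huw with
  | single h1 => exact h _ _ h1
  | tail _ h1 ih => exact ih.trans (h _ _ h1)

open Classical in
/-- The tensor graph of a network. -/
def toGraph : TensorGraph N where
  V := D.Node
  H := D.HEdge
  E := D.VEdge
  Color := D.Color
  hsrc e := ⟨(e.1.1, false, e.1.2.1), e.2.1⟩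
  htgt e := ⟨(e.1.1, true, e.1.2.2), e.2.2.1⟩
  vsrc e := ⟨(e.1.1.castSucc, true, e.1.2), e.2⟩
  vtgt e := ⟨(e.1.1.succ, false, e.1.2), by simpa using e.2⟩
  source := ⟨(0, false, D.base), by simpa using (D.ok_zero _).2 rfl⟩
  terminal := ⟨(Fin.last N, true, D.base), by simpa using (D.ok_last _).2 rfl⟩
  height v := v.1.1
  level e := e.1.1
  amp e := D.amp e.1.1 e.1.2
  color e := D.color e.1.1 e.1.2
  h_simple := by
    rintro ⟨⟨h, a, b⟩, _⟩ ⟨⟨h', a', b'⟩, _⟩ he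
    simp only [Prod.mk.injEq, Subtype.mk.injEq] at he ⊢
    tauto
  vsrc_inj := by
    rintro ⟨⟨h, a⟩, _⟩ ⟨⟨h', a'⟩, _⟩ he
    simpa only [Prod.mk.injEq, Subtype.mk.injEq, true_and, Fin.castSucc_inj] using he
  vtgt_inj := by
    rintro ⟨⟨h, a⟩, _⟩ ⟨⟨h', a'⟩, _⟩ he
    simpa only [Prod.mk.injEq, Subtype.mk.injEq, true_and, Fin.succ_inj] using he
  height_source := rfl
  height_terminal := rfl
  height_h _ := rfl
  height_vsrc _ := rfl
  height_vtgt _ := rfl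
  acyclic v hv := by
    refine lt_irrefl _ (rank_lt_of_transGen D.rank ?_ hv)
    rintro u w (⟨e, rfl, rfl⟩ | ⟨e, rfl, rfl⟩)
    · simp [rank]
    · simp [rank]; omega
  source_iff := by
    rintro ⟨⟨h, b, κ⟩, hv⟩
    constructor
    · rintro ⟨h1, h2⟩
      cases b with
      | true =>
        obtain ⟨κ', hκ', hr⟩ := D.exists_pred _ _ hv
        exact absurd rfl (h1 ⟨(h, κ', κ), hκ', hv, hr⟩)
      | false =>
        induction h using Fin.cases with
        | zero =>
          obtain rfl := (D.ok_zero κ).1 (by simpa using hv)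
          rfl
        | succ i => exact absurd rfl (h2 ⟨(i, κ), by simpa using hv⟩)
    · intro he
      simp only [Prod.mk.injEq, Subtype.mk.injEq] at he
      obtain ⟨rfl, rfl, rfl⟩ := he
      refine ⟨fun e he => ?_, fun e he => ?_⟩
      · simp at he
      · simp [Fin.succ_ne_zero] at he
  terminal_iff := by
    rintro ⟨⟨h, b, κ⟩, hv⟩
    constructor
    · rintro ⟨h1, h2⟩
      cases b with
      | false =>
        obtain ⟨κ', hκ', hr⟩ := D.exists_succ _ _ hv
        exact absurd rfl (h1 ⟨(h, κ, κ'), hv, hκ', hr⟩)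
      | true =>
        induction h using Fin.lastCases with
        | last =>
          obtain rfl := (D.ok_last κ).1 (by simpa using hv)
          rfl
        | cast i => exact absurd rfl (h2 ⟨(i, κ), by simpa using hv⟩)
    · intro he
      simp only [Prod.mk.injEq, Subtype.mk.injEq] at he
      obtain ⟨rfl, rfl, rfl⟩ := he
      refine ⟨fun e he => ?_, fun e he => ?_⟩
      · simp at he
      · simp [Fin.castSucc_ne_last] at he

/-! ### Paths -/

/-- The sequence of states is allowed and linked at positions `h, …, N + 1`. -/
def LinkedFrom (a : ℕ → D.K) (h : ℕ) : Prop :=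
  ∀ j, h ≤ j → j ≤ N → D.ok j (a j) ∧ D.ok (j + 1) (a (j + 1)) ∧ D.rel j (a j) (a (j + 1))

open Classical in
/-- The choices of one state for each line that are compatible with the relations. -/
def walks : Finset (Fin N → D.K) :=
  Finset.univ.filter fun a => D.LinkedFrom (extend a D.base) 0

theorem mem_walks {a : Fin N → D.K} :
    a ∈ D.walks ↔ D.LinkedFrom (extend a D.base) 0 := by
  simp [walks]

/-- The data of an edge, without proofs. -/
def code : D.toGraph.H ⊕ D.toGraph.E → (ℕ × D.K × D.K) ⊕ (ℕ × D.K) :=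
  Sum.map (fun e : D.HEdge => ((e.1.1 : ℕ), e.1.2)) (fun e : D.VEdge => ((e.1.1 : ℕ), e.1.2))

theorem code_injective : Function.Injective D.code := by
  refine Function.Injective.sumMap ?_ ?_
  · rintro ⟨⟨⟨h, _⟩, a, b⟩, _⟩ ⟨⟨⟨h', _⟩, a', b'⟩, _⟩ he
    simp only [Prod.mk.injEq] at he
    obtain ⟨rfl, rfl, rfl⟩ := he
    rfl
  · rintro ⟨⟨⟨h, _⟩, a⟩, _⟩ ⟨⟨⟨h', _⟩, a'⟩, _⟩ he
    simp only [Prod.mk.injEq] at he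
    obtain ⟨rfl, rfl⟩ := he
    rfl

/-- The codes of the edges on the path that goes from height `h` through the states `a`. -/
def codePath {K : Type} (a : ℕ → K) : ℕ → ℕ → List ((ℕ × K × K) ⊕ (ℕ × K))
  | h, 0 => [Sum.inl (h, a h, a (h + 1))]
  | h, k + 1 => Sum.inl (h, a h, a (h + 1)) :: Sum.inr (h, a (h + 1)) :: codePath a (h + 1) k

theorem codePath_congr {K : Type} {a b : ℕ → K} (k : ℕ) : ∀ h : ℕ,
    (∀ j, h ≤ j → j ≤ h + k + 1 → a j = b j) → codePath a h k = codePath b h k := by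
  induction k with
  | zero => intro h H; simp [codePath, H h (by omega) (by omega), H (h + 1) (by omega) (by omega)]
  | succ k ih =>
    intro h H
    simp [codePath, H h (by omega) (by omega), H (h + 1) (by omega) (by omega),
      ih (h + 1) (fun j h1 h2 => H j (by omega) (by omega))]

/-- Heights never decrease along a path; this is what excludes repeated edges. -/
theorem le_of_mem_codePath {K : Type} (a : ℕ → K) (k : ℕ) : ∀ h : ℕ, ∀ y ∈ codePath a h k,
    h ≤ Sum.elim (fun p => p.1) (fun p => p.1) y := by
  induction k with
  | zero => intro h y hy; simp [codePath] at hy; simp [hy]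
  | succ k ih =>
    intro h y hy
    simp only [codePath, List.mem_cons] at hy
    rcases hy with rfl | rfl | hy
    · simp
    · simp
    · exact (Nat.le_succ h).trans (ih _ _ hy)

theorem nodup_codePath {K : Type} (a : ℕ → K) (k : ℕ) : ∀ h : ℕ, (codePath a h k).Nodup := by
  induction k with
  | zero => intro h; simp [codePath]
  | succ k ih =>
    intro h
    simp only [codePath, List.nodup_cons, List.mem_cons, not_or]
    refine ⟨⟨by simp, fun hm => ?_⟩, fun hm => ?_, ih _⟩
    · have := le_of_mem_codePath a k _ _ hm; simp at this
    · have := le_of_mem_codePath a k _ _ hm; simp at this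

theorem filterMap_getRight?_inl {α β : Type*} (a : α) (l : List (α ⊕ β)) :
    (Sum.inl a :: l).filterMap Sum.getRight? = l.filterMap Sum.getRight? := rfl

theorem filterMap_getRight?_inr {α β : Type*} (b : β) (l : List (α ⊕ β)) :
    (Sum.inr b :: l).filterMap Sum.getRight? = b :: l.filterMap Sum.getRight? := rfl

theorem filterMap_codePath {K : Type} (a : ℕ → K) (k : ℕ) : ∀ h : ℕ,
    (codePath a h k).filterMap Sum.getRight? =
      (List.range' h k).map fun j => (j, a (j + 1)) := by
  induction k with
  | zero => intro h; simp [codePath]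
  | succ k ih => 
    intro h
    rw [codePath, filterMap_getRight?_inl, filterMap_getRight?_inr, ih,
      List.range'_succ, List.map_cons]

/-- Here `k` counts the lines still to be crossed. The path alternates horizontal and vertical
edges, beginning and ending with a horizontal one. -/
theorem exists_leads (a : ℕ → D.K) (hN : a (N + 1) = D.base) (k : ℕ) :
    ∀ (h : ℕ) (_ : h + k = N) (hl : D.LinkedFrom a h) (hh : h < N + 1),
    ∃ l, D.toGraph.Leads ⟨(⟨h, hh⟩, false, a h), (hl h le_rfl (by omega)).1⟩ l
      D.toGraph.terminal ∧ l.map D.code = codePath a h k := by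
  induction k with
  | zero =>
    intro h hk hl hh
    obtain rfl : h = N := by omega
    refine ⟨[Sum.inl ⟨(⟨h, hh⟩, a h, a (h + 1)), hl h le_rfl le_rfl⟩], ⟨rfl, ?_⟩, rfl⟩
    refine Subtype.ext ?_
    simp only [TensorGraph.tgt, toGraph, Sum.elim_inl, hN]
    rfl
  | succ k ih =>
    intro h hk hl hh
    obtain ⟨l, h1, h2⟩ := ih (h + 1) (by omega) (fun j hj => hl j (by omega)) (by omega)
    refine ⟨Sum.inl ⟨(⟨h, hh⟩, a h, a (h + 1)), hl h le_rfl (by omega)⟩ ::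
      Sum.inr ⟨(⟨h, by omega⟩, a (h + 1)), (hl h le_rfl (by omega)).2.1⟩ :: l,
      ⟨rfl, rfl, h1⟩, ?_⟩
    simp only [List.map_cons, h2]
    rfl

theorem exists_of_leads (k : ℕ) :
    ∀ (h : ℕ) (_ : h + k = N) (hh : h < N + 1) (κ : D.K) (hκ : D.ok h κ)
      (l : List (D.toGraph.H ⊕ D.toGraph.E)),
    D.toGraph.Leads ⟨(⟨h, hh⟩, false, κ), hκ⟩ l D.toGraph.terminal →
    ∃ a : ℕ → D.K, a h = κ ∧ a (N + 1) = D.base ∧ D.LinkedFrom a h ∧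
      l.map D.code = codePath a h k := by
  induction k with
  | zero =>
    intro h hk hh κ hκ l hl
    obtain rfl : h = N := by omega
    -- Only horizontal edges leave a node with flag `false`, and they end at flag `true`. From there
    -- only vertical edges leave, and none at height `N`, so the path is a single horizontal edge.
    match l, hl with
    | [], hl => simp [TensorGraph.Leads, toGraph] at hl
    | Sum.inr e :: _, ⟨he, _⟩ =>
      have : true = false := congrArg (fun v : D.Node => v.1.2.1) he
      cases this
    | Sum.inl ⟨⟨h', a, b⟩, hv⟩ :: m, ⟨he, hm⟩ =>
      have he := congrArg Subtype.val he
      simp only [TensorGraph.src, toGraph, Sum.elim_inl, Prod.mk.injEq] at he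
      obtain ⟨rfl, -, rfl⟩ := he
      have hb := (D.ok_last b).1 hv.2.1
      match m, hm with
      | [], _ =>
        refine ⟨fun j => if j = h then a else b, by simp, by simp [hb], ?_, ?_⟩
        · intro j h1 h2
          obtain rfl : j = h := by omega
          simpa using hv
        · simp only [codePath, List.map_cons, List.map_nil, if_pos, if_neg (Nat.succ_ne_self h)]
          rfl
      | Sum.inl e :: _, ⟨he, _⟩ =>
        have : false = true := congrArg (fun v : D.Node => v.1.2.1) he
        cases this
      | Sum.inr e :: _, ⟨he, _⟩ =>
        have h1 : (e.1.1 : ℕ) = h := congrArg (fun v : D.Node => (v.1.1 : ℕ)) he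
        exact absurd e.1.1.2 (by omega)
  | succ k ih =>
    intro h hk hh κ hκ l hl
    match l, hl with
    | [], hl => simp [TensorGraph.Leads, toGraph] at hl
    | Sum.inr e :: _, ⟨he, _⟩ =>
      have : true = false := congrArg (fun v : D.Node => v.1.2.1) he
      cases this
    | Sum.inl ⟨⟨h', a, b⟩, hv⟩ :: m, ⟨he, hm⟩ =>
      have he := congrArg Subtype.val he
      simp only [TensorGraph.src, toGraph, Sum.elim_inl, Prod.mk.injEq] at he
      obtain ⟨rfl, -, rfl⟩ := he
      match m, hm with
      | [], hm =>
        have h1 : h = N := congrArg (fun v : D.Node => (v.1.1 : ℕ)) hm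
        omega
      | Sum.inl e :: _, ⟨he, _⟩ =>
        have : false = true := congrArg (fun v : D.Node => v.1.2.1) he
        cases this
      | Sum.inr ⟨⟨⟨i, hi⟩, c⟩, hc⟩ :: m', ⟨he, hm'⟩ =>
        have he := congrArg Subtype.val he
        simp only [TensorGraph.src, TensorGraph.tgt, toGraph, Sum.elim_inl, Sum.elim_inr,
          Prod.mk.injEq, Fin.castSucc_mk, Fin.mk.injEq] at he
        obtain ⟨rfl, -, rfl⟩ := he
        obtain ⟨f, hf1, hf2, hf3, hf4⟩ := ih (i + 1) (by omega) (by omega) c hc m' hm'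
        have hne : ∀ j, i + 1 ≤ j → (if j = i then a else f j) = f j :=
          fun j hj => if_neg (by omega)
        refine ⟨fun j => if j = i then a else f j, by simp, ?_, ?_, ?_⟩
        · dsimp only
          rw [hne _ (by omega), hf2]
        · intro j h1 h2
          rcases h1.eq_or_lt with rfl | h1
          · dsimp only
            rw [hne _ le_rfl, hf1, if_pos rfl]
            exact hv
          · dsimp only
            rw [hne _ h1, hne (j + 1) (by omega)]
            exact hf3 j h1 h2
        · rw [codePath, codePath_congr (b := f) k (i + 1) (fun j h1 _ => hne j h1), ← hf4]
          simp only [List.map_cons, if_pos, if_neg (Nat.succ_ne_self i), hf1]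
          rfl

theorem linkedFrom_congr {a b : ℕ → D.K} (h : ∀ j, j ≤ N + 1 → a j = b j)
    (ha : D.LinkedFrom a 0) : D.LinkedFrom b 0 := by
  intro j h1 h2
  rw [← h j (by omega), ← h (j + 1) (by omega)]
  exact ha j h1 h2

theorem exists_path {a : Fin N → D.K} (ha : a ∈ D.walks) :
    ∃ l ∈ D.toGraph.paths, l.1.map D.code = codePath (extend a D.base) 0 N := by
  classical
  have ha : D.LinkedFrom (extend a D.base) 0 := D.mem_walks.1 ha
  obtain ⟨l, h1, h2⟩ := D.exists_leads (extend a D.base) (extend_of_lt _ _ (by omega)) N 0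
    (by omega) ha (by omega)
  refine ⟨⟨l, List.Nodup.of_map D.code (h2 ▸ nodup_codePath _ _ _)⟩, ?_, h2⟩
  simp only [TensorGraph.paths, Finset.mem_filter, Finset.mem_univ, true_and]
  exact h1

theorem exists_walk {l : {l : List (D.toGraph.H ⊕ D.toGraph.E) // l.Nodup}}
    (hl : l ∈ D.toGraph.paths) :
    ∃ a ∈ D.walks, l.1.map D.code = codePath (extend a D.base) 0 N := by
  classical
  simp only [TensorGraph.paths, Finset.mem_filter, Finset.mem_univ, true_and] at hl
  obtain ⟨a, h1, h2, h3, h4⟩ := D.exists_of_leads N 0 (by omega) (by omega) D.base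
    ((D.ok_zero _).2 rfl) l.1 hl
  have he : ∀ j, j ≤ N + 1 → a j = extend (fun i : Fin N => a (i + 1)) D.base j :=
    fun j hj => (eq_extend D.base a h1 h2 hj).symm
  refine ⟨fun i => a (i + 1), ?_, ?_⟩
  · exact D.mem_walks.2 (D.linkedFrom_congr he h3)
  · rw [h4]
    exact codePath_congr N 0 fun j _ hj => he j (by omega)

theorem codePath_extend_injective {a b : Fin N → D.K}
    (h : codePath (extend a D.base) 0 N = codePath (extend b D.base) 0 N) : a = b := by
  have h := congrArg (List.filterMap Sum.getRight?) h
  simp only [filterMap_codePath, List.map_inj_left] at h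
  funext i
  simpa using h i (by simp [List.mem_range'])

/-- Sums over paths are sums over walks. -/
theorem sum_paths {M : Type*} [AddCommMonoid M]
    (f : List ((ℕ × D.K × D.K) ⊕ (ℕ × D.K)) → M) :
    ∑ l ∈ D.toGraph.paths, f (l.1.map D.code) =
      ∑ a ∈ D.walks, f (codePath (extend a D.base) 0 N) := by
  symm
  -- Codes determine the edges and the states, so comparing codes suffices for both injectivity and
  -- surjectivity.
  choose g hg1 hg2 using fun (a : Fin N → D.K) (ha : a ∈ D.walks) => D.exists_path ha
  refine Finset.sum_bij g hg1 ?_ ?_ ?_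
  · intro a ha b hb h
    exact D.codePath_extend_injective (by rw [← hg2 a ha, ← hg2 b hb, h])
  · intro l hl
    obtain ⟨a, ha, h⟩ := D.exists_walk hl
    refine ⟨a, ha, Subtype.ext (List.map_injective_iff.2 D.code_injective ?_)⟩
    rw [hg2, h]
  · intro a ha
    rw [hg2]

theorem card_paths : D.toGraph.paths.card = D.walks.card := by
  simpa using D.sum_paths (fun _ => (1 : ℕ))

/-- The factor of a state at a line in the amplitude of `|x⟩`. -/
def factor (x : Bits N) (p : ℕ × D.K) : ColorAlgebra D.Color :=
  if h : p.1 < N then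
    ColorAlgebra.term (D.color ⟨p.1, h⟩ p.2) (D.amp ⟨p.1, h⟩ p.2 (x ⟨p.1, h⟩)) else 0

theorem amplitude_eq (x : Bits N) :
    D.toGraph.amplitude x = ∑ a ∈ D.walks,
      ((List.range N).map fun j => D.factor x (j, extend a D.base (j + 1))).foldl
        (fun a b : ColorAlgebra D.Color => a * b) (1 : ColorAlgebra D.Color) := by
  have key : ∀ l : List (D.toGraph.H ⊕ D.toGraph.E),
      (((l.filterMap Sum.getRight?).map (D.toGraph.edgeAmp x) : List (ColorAlgebra D.Color))) =
        ((l.map D.code).filterMap Sum.getRight?).map (D.factor x) := by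
    intro l
    induction l with
    | nil => rfl
    | cons e l ih =>
      rcases e with e | e
      · exact ih
      · refine congrArg₂ List.cons (Eq.symm ?_) ih
        exact dif_pos e.1.1.2
  have h1 : ∀ l : List (D.toGraph.H ⊕ D.toGraph.E), D.toGraph.pathAmp x l =
      (((l.map D.code).filterMap Sum.getRight?).map (D.factor x)).foldl
        (fun a b : ColorAlgebra D.Color => a * b) (1 : ColorAlgebra D.Color) :=
    fun l => congrArg (List.foldl (fun a b : ColorAlgebra D.Color => a * b)
      (1 : ColorAlgebra D.Color)) (key l)
  have h2 := D.sum_paths (fun l => ((l.filterMap Sum.getRight?).map (D.factor x)).foldl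
      (fun a b : ColorAlgebra D.Color => a * b) (1 : ColorAlgebra D.Color))
  refine (Finset.sum_congr rfl fun l _ => h1 l.1).trans
    (h2.trans (Finset.sum_congr rfl fun a _ => ?_))
  rw [filterMap_codePath, List.map_map, List.range_eq_range']
  rfl

end Network

/-! ### Ordered products in the algebra of colors -/

namespace ColorAlgebra

variable {κ : Type}

theorem zero_mul' (g : ColorAlgebra κ) : (0 : ColorAlgebra κ) * g = 0 := Finsupp.sum_zero_index

open Classical in
/-- The product, in order, of factors in which every color occurs exactly twice. -/
theorem foldl_term (lab : ℕ → κ → Option Bool) (amp : ℕ → ℂ) (first last : κ → ℕ)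
    (hlt : ∀ c, first c < last c)
    (hlab : ∀ l c, lab l c ≠ none ↔ l = first c ∨ l = last c) (h : ℕ) :
    ((List.range h).map fun l => term (lab l) (amp l)).foldl
        (fun a b : ColorAlgebra κ => a * b) 1 =
      if ∀ c, last c < h → lab (first c) c = lab (last c) c then
        term (fun c => if first c < h ∧ h ≤ last c then lab (first c) c else none)
          (∏ l ∈ Finset.range h, amp l)
      else 0 := by
  -- Invariant for the first `h` factors: colors already seen twice must have matched, and the
  -- current monomial consists of the colors seen exactly once. The next factor opens new colors and
  -- closes those with `last c = h`; a mismatch makes the product zero, which then persists.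
  induction h with
  | zero => simp; rfl
  | succ h ih =>
    rw [List.range_succ, List.map_append, List.foldl_append, ih]
    simp only [List.map_cons, List.map_nil, List.foldl_cons, List.foldl_nil]
    by_cases hg : ∀ c, last c < h → lab (first c) c = lab (last c) c
    · rw [if_pos hg, term_mul_term, Finset.prod_range_succ]
      have hc : (∃ c u, (if first c < h ∧ h ≤ last c then lab (first c) c else none) = some u ∧
          lab h c = some (!u)) ↔ ¬ ∀ c, last c < h + 1 → lab (first c) c = lab (last c) c := by
        push Not
        constructor
        · rintro ⟨c, u, h1, h2⟩
          have h3 := (hlab h c).1 (by simp [h2])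
          have h4 : first c < h ∧ h ≤ last c := by
            by_contra h4
            rw [if_neg h4] at h1
            cases h1
          rw [if_pos h4] at h1
          obtain rfl : h = last c := by omega
          refine ⟨c, by omega, ?_⟩
          rw [h1, h2]
          cases u <;> simp
        · rintro ⟨c, h1, h2⟩
          obtain rfl : h = last c := by
            by_contra h3
            exact h2 (hg c (by omega))
          obtain ⟨u, hu⟩ := Option.ne_none_iff_exists'.1 ((hlab (first c) c).2 (Or.inl rfl))
          obtain ⟨v, hv⟩ := Option.ne_none_iff_exists'.1 ((hlab (last c) c).2 (Or.inr rfl))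
          refine ⟨c, u, by rw [if_pos ⟨hlt c, le_rfl⟩, hu], ?_⟩
          rw [hu, hv] at h2
          rw [hv]
          cases u <;> cases v <;> simp_all
      by_cases hg' : ∀ c, last c < h + 1 → lab (first c) c = lab (last c) c
      · rw [if_pos hg', ColorMonomial.mul, if_neg (fun h => hc.1 h hg')]
        dsimp only
        congr 1
        funext c
        have h1 := hlab h c
        have h2 := hlt c
        rcases lt_trichotomy h (first c) with h3 | h3 | h3
        · have : lab h c = none := by
            by_contra h4
            have := h1.1 h4
            omega
          rw [if_neg (by omega), if_neg (by omega), this]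
        · subst h3
          rw [if_neg (by omega), if_pos (by omega)]
        · rcases lt_trichotomy h (last c) with h4 | h4 | h4
          · have : lab h c = none := by
              by_contra h5
              have := h1.1 h5
              omega
            rw [if_pos (by omega), if_pos (by omega), this]
            cases lab (first c) c <;> rfl
          · subst h4
            rw [if_pos (by omega), if_neg (by omega)]
            have h5 := hg' c (by omega)
            rw [h5]
            cases lab (last c) c <;> rfl
          · have : lab h c = none := by
              by_contra h4
              have := h1.1 h4
              omega
            rw [if_neg (by omega), if_neg (by omega), this]
      · rw [if_neg hg', ColorMonomial.mul, if_pos (hc.2 hg')]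
    · rw [if_neg hg, if_neg (fun h1 => hg fun c hc => h1 c (by omega)), zero_mul']

end ColorAlgebra

/-! ### Amplitudes, width and size of the graph of a network -/

namespace Network

variable {N : ℕ} (D : Network N)

open Classical in
/-- The amplitudes in the graph of a network in which every color occurs at exactly two lines: the
sum over the walks in which the colors match. -/
theorem amplitude_eq_scalar (first last : D.Color → Fin N) (hlt : ∀ c, first c < last c)
    (hcol : ∀ i κ c, D.color i κ c ≠ none ↔ i = first c ∨ i = last c) (x : Bits N) :
    D.toGraph.amplitude x = ColorAlgebra.scalar
      (∑ a ∈ D.walks.filter (fun a => ∀ c, D.color (first c) (a (first c)) c =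
          D.color (last c) (a (last c)) c), ∏ i, D.amp i (a i) (x i)) := by
  rw [amplitude_eq, Finset.sum_filter, ColorAlgebra.scalar, ColorAlgebra.term]
  refine Eq.trans ?_ (map_sum (Finsupp.singleAddHom (fun _ => none)) _ _).symm
  refine Finset.sum_congr rfl fun a _ => ?_
  set lab : ℕ → D.Color → Option Bool :=
    fun l => if h : l < N then D.color ⟨l, h⟩ (a ⟨l, h⟩) else fun _ => none with hlabdef
  have hlab' : ∀ i : Fin N, lab i = D.color i (a i) := fun i => dif_pos i.2
  set am : ℕ → ℂ := fun l => if h : l < N then D.amp ⟨l, h⟩ (a ⟨l, h⟩) (x ⟨l, h⟩) else 0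
  have h1 : ((List.range N).map fun j => D.factor x (j, extend a D.base (j + 1))) =
      (List.range N).map fun l => ColorAlgebra.term (lab l) (am l) := by
    refine List.map_congr_left fun l hl => ?_
    have hl := List.mem_range.1 hl
    simp only [factor, lab, am, hl, dif_pos, extend]
  rw [h1, ColorAlgebra.foldl_term lab am (fun c => first c) (fun c => last c) hlt]
  · have h2 : ∏ l ∈ Finset.range N, am l = ∏ i, D.amp i (a i) (x i) := by
      rw [Finset.prod_range]
      exact Finset.prod_congr rfl fun i _ => dif_pos i.2
    -- After all `N` factors every color is closed, so the remaining monomial is trivial and the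
    -- amplitude is a scalar.
    simp only [hlab', h2, (last _).2, forall_const, Finsupp.singleAddHom_apply]
    split_ifs
    · refine congrArg (fun m => ColorAlgebra.term m _) (funext fun c => if_neg ?_)
      have := (last c).2
      omega
    · exact (Finsupp.single_zero _).symm
  · intro l c
    by_cases hl : l < N
    · simp only [lab, dif_pos hl, hcol, Fin.ext_iff]
    · simp only [lab, dif_neg hl]
      have h3 := (first c).2
      have h4 := (last c).2
      simp
      omega

theorem width_le : D.toGraph.width ≤ 2 * Fintype.card D.K := by
  classical
  refine Finset.sup_le fun h _ => ?_
  refine (Finset.card_le_card_of_injOn (t := (Finset.univ : Finset (Bool × D.K)))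
    (fun v : D.toGraph.V => (show D.Node from v).1.2) (fun _ _ => Finset.mem_univ _) ?_).trans
    (by simp)
  intro u hu v hv huv
  have hu : D.toGraph.height u = h := by simpa using hu
  have hv : D.toGraph.height v = h := by simpa using hv
  exact Subtype.ext (Prod.ext (hu.trans hv.symm) huv)

theorem size_le : D.toGraph.size ≤
    (N + 1) * (2 * Fintype.card D.K + Fintype.card D.K ^ 2 + Fintype.card D.K) := by
  classical
  have h1 : Fintype.card D.toGraph.V ≤ (N + 1) * (2 * Fintype.card D.K) := by
    refine (Fintype.card_le_of_injective (β := Fin (N + 1) × Bool × D.K)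
      (Subtype.val : D.Node → _) Subtype.val_injective).trans (by simp)
  have h2 : Fintype.card D.toGraph.H ≤ (N + 1) * (Fintype.card D.K ^ 2) := by
    refine (Fintype.card_le_of_injective (β := Fin (N + 1) × D.K × D.K)
      (Subtype.val : D.HEdge → _) Subtype.val_injective).trans (by simp [sq])
  have h3 : Fintype.card D.toGraph.E ≤ N * Fintype.card D.K := by
    refine (Fintype.card_le_of_injective (β := Fin N × D.K)
      (Subtype.val : D.VEdge → _) Subtype.val_injective).trans (by simp)
  rw [TensorGraph.size]
  nlinarith

end Network

/-! ### Tensor rank of the gates -/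

/-- The operator is a sum of `d` Kronecker products of one-qubit operators. -/
def HasRank {N : ℕ} (d : ℕ) (A : QOp N) : Prop :=
  ∃ M : Fin N → Fin d → Matrix (Fin 2) (Fin 2) ℂ, ∀ x y, A x y = ∑ k, ∏ i, M i k (x i) (y i)

/-- Padding with zero matrices adds zero terms only if there is a line: the empty product would be
1, whence `0 < N`. -/
theorem HasRank.mono {N d d' : ℕ} (hN : 0 < N) {A : QOp N} (hA : HasRank d' A) (hd : d' ≤ d) :
    HasRank d A := by
  obtain ⟨M, hM⟩ := hA
  refine ⟨fun i k => if h : (k : ℕ) < d' then M i ⟨k, h⟩ else 0, fun x y => ?_⟩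
  set f : ℕ → ℂ := fun k => if h : k < d' then ∏ i, M i ⟨k, h⟩ (x i) (y i) else 0 with hf
  have h1 : ∀ k : Fin d, ∏ i, (if h : (k : ℕ) < d' then M i ⟨k, h⟩ else 0) (x i) (y i) = f k := by
    intro k
    by_cases h : (k : ℕ) < d'
    · simp [hf, h]
    · simp only [hf, h, dif_neg, not_false_iff, Matrix.zero_apply]
      exact Finset.prod_eq_zero (Finset.mem_univ ⟨0, hN⟩) rfl
  have h2 : ∀ k : Fin d', ∏ i, M i k (x i) (y i) = f k := fun k => by simp [hf]
  simp only [hM, h1, h2, ← Finset.sum_range]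
  refine Finset.sum_subset (Finset.range_subset_range.2 hd) fun k _ hk => ?_
  simp only [hf]
  exact dif_neg (by simpa using hk)

theorem eq_iff_castSucc_last {α : Type*} {m : ℕ} (x y : Fin (m + 1) → α) :
    x = y ↔ (∀ i : Fin m, x i.castSucc = y i.castSucc) ∧ x (Fin.last m) = y (Fin.last m) := by
  rw [funext_iff, Fin.forall_fin_succ']

theorem fin_two_eq_add_one_iff (a b : Fin 2) : a = b + 1 ↔ a ≠ b := by
  revert a b; decide

/-- The gate is `1 + (|1⟩⟨1| ⊗ ⋯ ⊗ |1⟩⟨1|) ⊗ (X - 1)`. -/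
theorem hasRank_toffoli (m : ℕ) : HasRank 2 (Gate.toffoli m).toOp := by
  refine ⟨Fin.lastCases
    (fun k => Matrix.of fun a b => if k = 0 then (if a = b then 1 else 0)
      else (if a = b then -1 else 1))
    (fun _ k => Matrix.of fun a b => if k = 0 then (if a = b then 1 else 0)
      else (if a = b ∧ b = 1 then 1 else 0)), fun x y => ?_⟩
  simp only [Gate.toOp, basisMap, eq_iff_castSucc_last x, Fin.sum_univ_two,
    Fin.prod_univ_castSucc, Fin.lastCases_last, Fin.lastCases_castSucc, Matrix.of_apply,
    Finset.prod_ite_zero, Finset.prod_const_one, Function.update_self, if_true, one_ne_zero,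
    if_false, Finset.mem_univ, forall_const, Function.update_of_ne (Fin.castSucc_lt_last _).ne,
    forall_and]
  by_cases h1 : ∀ i : Fin m, x i.castSucc = y i.castSucc
  · by_cases h2 : ∀ i : Fin m, y i.castSucc = 1
    · simp only [h1, h2, fin_two_eq_add_one_iff, implies_true, true_and, and_true, if_true]
      split_ifs <;> simp_all
    · simp [h1, h2]
  · simp [h1]

/-- The gate is the sum over the control bit `k` of `X ^ k ⊗ ⋯ ⊗ X ^ k ⊗ |k⟩⟨k|`. -/
theorem hasRank_fanOut (m : ℕ) : HasRank 2 (Gate.fanOut m).toOp := by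
  refine ⟨Fin.lastCases
    (fun k => Matrix.of fun a b => if a = b ∧ b = k then 1 else 0)
    (fun _ k => Matrix.of fun a b => if a = k + b then 1 else 0), fun x y => ?_⟩
  simp only [Gate.toOp, basisMap, eq_iff_castSucc_last x,
    Fin.prod_univ_castSucc, Fin.lastCases_last, Fin.lastCases_castSucc, Matrix.of_apply,
    Finset.prod_ite_zero, Finset.prod_const_one, if_true,
    Finset.mem_univ, forall_const, (Fin.castSucc_lt_last _).ne, if_false]
  rw [Finset.sum_eq_single (y (Fin.last m))]
  · split_ifs <;> simp_all
  · intro k _ hk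
    simp [hk.symm]
  · simp

/-- Orthogonality of characters: a geometric sum of ratio `ω ^ s / ω ^ r`, a `q`-th root of unity
that is 1 exactly when `s ≡ r`. -/
theorem sum_pow_of_isPrimitiveRoot {q : ℕ} (hq : q ≠ 0) {ω : ℂ} (hω : IsPrimitiveRoot ω q)
    (s r : ℕ) :
    ∑ k : Fin q, ω ^ (k * s : ℕ) * (ω ^ (k * r : ℕ))⁻¹ = if s ≡ r [MOD q] then (q : ℂ) else 0 := by
  have hr : ω ^ r ≠ 0 := pow_ne_zero _ (hω.ne_zero hq)
  set ζ : ℂ := ω ^ s * (ω ^ r)⁻¹ with hζ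
  have h1 : ∀ k : Fin q, ω ^ (k * s : ℕ) * (ω ^ (k * r : ℕ))⁻¹ = ζ ^ (k : ℕ) := by
    intro k
    rw [hζ, mul_pow, inv_pow, ← pow_mul, ← pow_mul, mul_comm s, mul_comm r]
  have h2 : ζ = 1 ↔ s ≡ r [MOD q] := by
    
    rw [hζ, mul_inv_eq_one₀ hr, (hω.isOfFinOrder hq).pow_eq_pow_iff_modEq, ← hω.eq_orderOf]
  simp only [h1, ← Finset.sum_range (fun k => ζ ^ k)]
  split_ifs with h
  · simp [h2.2 h]
  · have h3 : ζ ^ q = 1 := by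
      rw [hζ, mul_pow, inv_pow, ← pow_mul, ← pow_mul, mul_comm s, mul_comm r, pow_mul, pow_mul,
        hω.pow_eq_one]
      simp
    rw [geom_sum_eq (fun h4 => h (h2.1 h4)), h3]
    simp

/-- The gate is the identity plus the indicator of `s ≡ r` times `X - 1` on the target, `s` being
the sum of the other bits. The indicator expands into `q` characters `ω ^ (k * s)`, each a product
over the lines. The identity needs no extra term: for `k = 0` the character is trivial, so it is
absorbed into the target operator of that term. -/
theorem hasRank_modGate {q : ℕ} (hq : q ≠ 0) (r m : ℕ) : HasRank q (Gate.modGate q r m).toOp := by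
  obtain ⟨ω, hω⟩ : ∃ ω : ℂ, IsPrimitiveRoot ω q := ⟨_, Complex.isPrimitiveRoot_exp q hq⟩
  refine ⟨Fin.lastCases
    (fun k => Matrix.of fun a b => (if (k : ℕ) = 0 ∧ a = b then 1 else 0) +
      (q : ℂ)⁻¹ * (ω ^ (k * r : ℕ))⁻¹ * (if a = b then -1 else 1))
    (fun _ k => Matrix.of fun a b => if a = b then ω ^ (k * (b : ℕ) : ℕ) else 0), fun x y => ?_⟩
  simp only [Gate.toOp, basisMap, eq_iff_castSucc_last x,
    Fin.prod_univ_castSucc, Fin.lastCases_last, Fin.lastCases_castSucc, Matrix.of_apply,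
    Finset.prod_ite_zero, Function.update_self,
    Finset.mem_univ, forall_const, Function.update_of_ne (Fin.castSucc_lt_last _).ne]
  by_cases h1 : ∀ i : Fin m, x i.castSucc = y i.castSucc
  · simp only [h1, implies_true, if_true, true_and, Finset.prod_pow_eq_pow_sum, ← Finset.mul_sum,
      mul_add, Finset.sum_add_distrib]
    have h2 : ∀ k : Fin q, ω ^ ((k : ℕ) * ∑ i : Fin m, (y i.castSucc : ℕ)) *
        ((q : ℂ)⁻¹ * (ω ^ (k * r : ℕ))⁻¹ *
          (if x (Fin.last m) = y (Fin.last m) then -1 else 1)) =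
        (q : ℂ)⁻¹ * (if x (Fin.last m) = y (Fin.last m) then -1 else 1) *
        (ω ^ ((k : ℕ) * ∑ i : Fin m, (y i.castSucc : ℕ)) * (ω ^ (k * r : ℕ))⁻¹) := by
      intro k; ring
    simp only [h2, ← Finset.mul_sum, sum_pow_of_isPrimitiveRoot hq hω]
    have h3 : ∑ k : Fin q, ω ^ ((k : ℕ) * ∑ i : Fin m, (y i.castSucc : ℕ)) *
        (if (k : ℕ) = 0 ∧ x (Fin.last m) = y (Fin.last m) then 1 else 0) =
        if x (Fin.last m) = y (Fin.last m) then 1 else 0 := by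
      rw [Finset.sum_eq_single (⟨0, Nat.pos_of_ne_zero hq⟩ : Fin q)]
      · simp
      · intro k _ hk
        rw [if_neg fun h => hk (Fin.ext h.1), mul_zero]
      · simp
    have hq' : (q : ℂ) ≠ 0 := Nat.cast_ne_zero.2 hq
    rw [h3]
    by_cases h4 : (∑ i : Fin m, (y i.castSucc : ℕ)) ≡ r [MOD q]
    · simp only [h4, if_true, fin_two_eq_add_one_iff]
      by_cases h5 : x (Fin.last m) = y (Fin.last m) <;> simp [h5, hq']
    · simp only [h4, if_false, add_zero, mul_zero]
  · simp [h1]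

/-- The copies that a gate on `a` lines needs. -/
def copies (e a : ℕ) : Finset (Fin (e + 2)) := if a = 1 then {0} else Finset.univ

theorem zero_mem_copies (e a : ℕ) : 0 ∈ copies e a := by
  unfold copies; split_ifs <;> simp

/-- A gate on one line needs a single term. This keeps one-qubit gates out of the count of choices,
and so out of the count of paths. -/
theorem Gate.exists_terms {q e a : ℕ} (hq : 2 ≤ q) {S : Set (Matrix.unitaryGroup (Fin 2) ℂ)}
    (g : Gate a) (hg : g.Allowed q S) (he : g.NotMod ∨ q ≤ e + 2) :
    ∃ M : Fin a → Fin (e + 2) → Matrix (Fin 2) (Fin 2) ℂ, ∀ x y,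
      g.toOp x y = ∑ k ∈ copies e a, ∏ i, M i k (x i) (y i) := by
  by_cases ha : a = 1
  · subst ha
    refine ⟨fun _ _ => Matrix.of fun b b' => g.toOp (fun _ => b) (fun _ => b'), fun x y => ?_⟩
    simp only [copies, if_true, Finset.sum_singleton, Fin.prod_univ_one, Matrix.of_apply]
    congr 1 <;> funext i <;> rw [Subsingleton.elim i 0]
  · simp only [copies, if_neg ha]
    suffices H : HasRank (e + 2) g.toOp from H
    cases g with
    | oneQubit U => exact absurd rfl ha
    | toffoli m => exact (hasRank_toffoli m).mono (Nat.succ_pos _) (by omega)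
    | fanOut m => exact (hasRank_fanOut m).mono (Nat.succ_pos _) (by omega)
    | modGate q' r m =>
      obtain rfl : q' = q := hg
      rcases he with he | he
      · exact he.elim
      · exact (hasRank_modGate (by omega) r m).mono (Nat.succ_pos _) he

/-! ### Sums of Kronecker products with constrained indices -/

/-- A sum of Kronecker products of one-qubit operators `M i k`. The indices `k` of the lines are
chosen in `ok i`, equal on linked consecutive lines and on the lines of each pair of `pairs`. -/
structure KronSum (N e : ℕ) where
  M : Fin N → Fin (e + 2) → Matrix (Fin 2) (Fin 2) ℂ
  ok : Fin N → Finset (Fin (e + 2))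
  link : Fin N → Fin N → Prop
  pairs : CNotLayer N
  zero_mem : ∀ i, 0 ∈ ok i
  ok_link : ∀ i j, link i j → ok i = ok j
  ok_control : ∀ i j, pairs.ctrl j = some i → ok i = {0, 1}
  ok_target : ∀ i j, pairs.ctrl j = some i → ok j = {0, 1}

namespace KronSum

variable {N e : ℕ} (D : KronSum N e)

open Classical in
/-- The choices of indices that respect `ok` and `link`. -/
def choices : Finset (Fin N → Fin (e + 2)) :=
  Finset.univ.filter fun b =>
    (∀ i, b i ∈ D.ok i) ∧ ∀ i j : Fin N, (i : ℕ) + 1 = j → D.link i j → b i = b j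

theorem mem_choices {b : Fin N → Fin (e + 2)} : b ∈ D.choices ↔
    (∀ i, b i ∈ D.ok i) ∧ ∀ i j : Fin N, (i : ℕ) + 1 = j → D.link i j → b i = b j := by
  simp [choices]

/-- The choice respects the pairs. -/
def Matched (b : Fin N → Fin (e + 2)) : Prop := ∀ i j, D.pairs.ctrl j = some i → b i = b j

open Classical in
/-- The operator. -/
def toOp : QOp N := fun x y =>
  ∑ b ∈ D.choices.filter D.Matched, ∏ i, D.M i (b i) (x i) (y i)

end KronSum

/-- The layer without controlled-not's. -/
def CNotLayer.empty (N : ℕ) : CNotLayer N := ⟨fun _ => none, by simp, by simp⟩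

/-! ### Tensor layers -/

section tensor

variable {N e : ℕ} (c : Composition N)
  (M : (b : Fin c.length) → Fin (c.blocksFun b) → Fin (e + 2) → Matrix (Fin 2) (Fin 2) ℂ)

/-- A Kronecker product of sums is a sum of Kronecker products. -/
def KronSum.ofComposition : KronSum N e where
  M i := M (c.blocksFinEquiv.symm i).1 (c.blocksFinEquiv.symm i).2
  ok i := copies e (c.blocksFun (c.index i))
  link i j := c.index i = c.index j
  pairs := CNotLayer.empty N
  zero_mem _ := zero_mem_copies _ _
  ok_link _ _ h := by rw [h]
  ok_control _ _ h := by cases h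
  ok_target _ _ h := by cases h

theorem KronSum.ofComposition_M (b : Fin c.length) (i : Fin (c.blocksFun b)) :
    (KronSum.ofComposition c M).M (c.embedding b i) = M b i := by
  have h : c.blocksFinEquiv.symm (c.embedding b i) = ⟨b, i⟩ :=
    c.blocksFinEquiv.symm_apply_apply ⟨b, i⟩
  change M (c.blocksFinEquiv.symm (c.embedding b i)).1 (c.blocksFinEquiv.symm _).2 = _
  rw [h]

theorem Composition.eq_of_linked {α : Type*} (c : Composition N) (b : Fin N → α)
    (hb : ∀ i j : Fin N, (i : ℕ) + 1 = j → c.index i = c.index j → b i = b j)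
    (k : Fin c.length) (i : Fin (c.blocksFun k)) :
    b (c.embedding k i) = b (c.embedding k ⟨0, c.one_le_blocksFun k⟩) := by
  obtain ⟨i, hi⟩ := i
  induction i with
  | zero => rfl
  | succ i ih =>
    rw [← ih (by omega)]
    refine (hb _ _ ?_ ?_).symm
    · simp [Composition.coe_embedding]; omega
    · simp [Composition.index_embedding]

/-- Equality on consecutive lines of a block propagates through the block, so a choice amounts to
one index per block. -/
theorem KronSum.sum_choices_ofComposition {A : Type*} [AddCommMonoid A]
    (f : (Fin N → Fin (e + 2)) → A) :
    ∑ b ∈ (KronSum.ofComposition c M).choices, f b =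
      ∑ k ∈ Fintype.piFinset fun b => copies e (c.blocksFun b), f fun i => k (c.index i) := by
  classical
  symm
  refine Finset.sum_bij (fun k _ i => k (c.index i)) ?_ ?_ ?_ (fun _ _ => rfl)
  · intro k hk
    rw [mem_choices]
    exact ⟨fun i => Fintype.mem_piFinset.1 hk _, fun i j _ h => by rw [h]⟩
  · intro k _ k' _ h
    funext b
    simpa [Composition.index_embedding] using
      congrFun h (c.embedding b ⟨0, c.one_le_blocksFun b⟩)
  · intro b hb
    rw [mem_choices] at hb
    refine ⟨fun k => b (c.embedding k ⟨0, c.one_le_blocksFun k⟩), ?_, ?_⟩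
    · rw [Fintype.mem_piFinset]
      intro k
      simpa [ofComposition, Composition.index_embedding] using hb.1 (c.embedding k ⟨0, c.one_le_blocksFun k⟩)
    · funext i
      dsimp only
      rw [← c.eq_of_linked b hb.2 (c.index i) (c.invEmbedding i), c.embedding_comp_inv]

theorem KronSum.toOp_ofComposition (A : (b : Fin c.length) → QOp (c.blocksFun b))
    (hA : ∀ b x y, A b x y = ∑ k ∈ copies e (c.blocksFun b), ∏ i, M b i k (x i) (y i)) :
    (KronSum.ofComposition c M).toOp = kron c A := by
  classical
  funext x y
  have h1 : (KronSum.ofComposition c M).choices.filter (KronSum.ofComposition c M).Matched =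
      (KronSum.ofComposition c M).choices :=
    Finset.filter_true_of_mem fun b _ i j h => by cases h
  simp only [toOp, h1, kron, hA, Finset.prod_univ_sum]
  rw [KronSum.sum_choices_ofComposition c M
    (fun b => ∏ i, (KronSum.ofComposition c M).M i (b i) (x i) (y i))]
  refine Finset.sum_congr rfl fun k _ => ?_
  rw [← Composition.prod_prod_apply_embedding _ c]
  refine Finset.prod_congr rfl fun b _ => Finset.prod_congr rfl fun i _ => ?_
  simp only [KronSum.ofComposition_M, Composition.index_embedding, Function.comp]

theorem KronSum.card_choices_ofComposition :
    (KronSum.ofComposition c M).choices.card ≤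
      (e + 2) ^ (Finset.univ.filter fun i => 1 < c.blocksFun i).card := by
  have h := KronSum.sum_choices_ofComposition c M (fun _ => 1)
  simp only [Finset.sum_const, smul_eq_mul, mul_one, Fintype.card_piFinset] at h
  rw [h, Finset.card_filter, ← Finset.prod_pow_eq_pow_sum]
  refine Finset.prod_le_prod' fun b _ => ?_
  have := c.one_le_blocksFun b
  unfold copies
  split_ifs <;> first | omega | simp

end tensor

/-! ### Controlled-not layers -/

namespace CNotLayer

variable {N : ℕ} (P : CNotLayer N)

/-- The line is a control. -/
def IsControl (i : Fin N) : Prop := ∃ j, P.ctrl j = some i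

theorem ctrl_eq_none_of_isControl {i : Fin N} (h : P.IsControl i) : P.ctrl i = none :=
  let ⟨j, hj⟩ := h
  P.ctrl_not_target i j hj

open Classical in
/-- A controlled-not is the sum, over the two values of the control, of a projection on the control
and a power of `X` on the target. -/
def toKronSum (e : ℕ) : KronSum N e where
  M i k := Matrix.of fun a b =>
    if P.IsControl i then (if a = b ∧ k = (if b = 1 then 1 else 0) then 1 else 0)
    else if a = b + (if k = 1 then 1 else 0) then 1 else 0
  ok i := if P.IsControl i ∨ P.ctrl i ≠ none then {0, 1} else {0}
  link _ _ := False
  pairs := P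
  zero_mem i := by split_ifs <;> simp
  ok_link _ _ h := h.elim
  ok_control i j h := if_pos (Or.inl ⟨j, h⟩)
  ok_target i j h := if_pos (Or.inr (by simp [h]))

theorem toOp_toKronSum (e : ℕ) : (P.toKronSum e).toOp = P.toOp := by
  classical
  funext x y
  let lab : Fin 2 → Fin (e + 2) := fun b => if b = 1 then 1 else 0
  -- For a given input `y` only this matched choice contributes: the projections force each
  -- control's index to be its bit, matching copies it to the target, and idle lines allow only the
  -- index 0.
  let b₀ : Fin N → Fin (e + 2) := fun i =>
    if P.IsControl i then lab (y i) else (P.ctrl i).elim 0 fun j => lab (y j)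
  have hlab : ∀ b, (if lab b = 1 then (1 : Fin 2) else 0) = b := by
    intro b
    fin_cases b <;> simp [lab]
  have hlab' : ∀ b, lab b = 0 ∨ lab b = 1 := by
    intro b
    fin_cases b <;> simp [lab]
  rw [KronSum.toOp, Finset.sum_eq_single b₀]
  · have h1 : ∀ i, (P.toKronSum e).M i (b₀ i) (x i) (y i) =
        if x i = (match P.ctrl i with | some j => y i + y j | none => y i) then 1 else 0 := by
      intro i
      simp only [toKronSum, Matrix.of_apply]
      by_cases hi : P.IsControl i
      · rw [if_pos hi, P.ctrl_eq_none_of_isControl hi]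
        simp [b₀, hi, lab]
      · rw [if_neg hi]
        cases hc : P.ctrl i with
        | none => simp [b₀, hi, hc]
        | some j => simp [b₀, hi, hc, hlab]
    simp only [h1, Finset.prod_ite_zero, Finset.prod_const_one, Finset.mem_univ, forall_const]
    simp only [CNotLayer.toOp, basisMap, funext_iff]
  · intro b hb hne
    obtain ⟨hb1, hb2⟩ := Finset.mem_filter.1 hb
    rw [KronSum.mem_choices] at hb1
    have hok := hb1.1
    by_contra h0
    have h0 := Finset.prod_ne_zero_iff.1 h0
    have hcontrol : ∀ i, P.IsControl i → b i = lab (y i) := by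
      intro i hi
      have := h0 i (Finset.mem_univ i)
      simp only [toKronSum, Matrix.of_apply, if_pos hi, ne_eq, ite_eq_right_iff, one_ne_zero,
        imp_false, not_not] at this
      exact this.2
    refine hne (funext fun i => ?_)
    by_cases hi : P.IsControl i
    · simp [b₀, hi, hcontrol i hi]
    · cases hc : P.ctrl i with
      | none =>
        have := hok i
        simpa [toKronSum, hi, hc, b₀] using this
      | some j =>
        have := hb2 j i hc
        rw [← this, hcontrol j ⟨i, hc⟩]
        simp [b₀, hi, hc]
  · intro h
    exfalso
    refine h (Finset.mem_filter.2 ⟨?_, ?_⟩)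
    · rw [KronSum.mem_choices]
      refine ⟨fun i => ?_, fun _ _ _ h => h.elim⟩
      simp only [toKronSum]
      by_cases hi : P.IsControl i
      · have := hlab' (y i)
        simpa [hi, b₀] using this
      · cases hc : P.ctrl i with
        | none => simp [hi, hc, b₀]
        | some j =>
          have := hlab' (y j)
          simpa [hi, hc, b₀] using this
    · intro i j hij
      replace hij : P.ctrl j = some i := hij
      have hi : P.IsControl i := ⟨j, hij⟩
      have hj : ¬ P.IsControl j := fun h => by
        rw [P.ctrl_eq_none_of_isControl h] at hij
        cases hij
      simp [b₀, hi, hj, hij]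

theorem card_choices_toKronSum (e : ℕ) : (P.toKronSum e).choices.card ≤
    (e + 2) ^ (2 * (Finset.univ.filter fun j => P.ctrl j ≠ none).card) := by
  classical
  have h1 : (P.toKronSum e).choices ⊆ Fintype.piFinset (P.toKronSum e).ok := by
    intro b hb
    rw [KronSum.mem_choices] at hb
    exact Fintype.mem_piFinset.2 hb.1
  refine (Finset.card_le_card h1).trans ?_
  rw [Fintype.card_piFinset]
  have h2 : (Finset.univ.filter fun i => P.IsControl i ∨ P.ctrl i ≠ none).card ≤
      2 * (Finset.univ.filter fun j => P.ctrl j ≠ none).card := by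
    rw [Finset.filter_or, two_mul]
    refine (Finset.card_union_le _ _).trans (Nat.add_le_add_right ?_ _)
    -- Each control is the control of some target, so there are no more controls than targets.
    have h3 : (Finset.univ.filter fun i => P.IsControl i) ⊆
        (Finset.univ.filter fun j => P.ctrl j ≠ none).image fun j => (P.ctrl j).getD j := by
      intro i hi
      obtain ⟨j, hj⟩ := (Finset.mem_filter.1 hi).2
      exact Finset.mem_image.2 ⟨j, by simp [hj], by simp [hj]⟩
    exact (Finset.card_le_card h3).trans Finset.card_image_le
  refine le_trans ?_ (Nat.pow_le_pow_right (by omega) h2)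
  rw [Finset.card_filter, ← Finset.prod_pow_eq_pow_sum]
  refine Finset.prod_le_prod' fun i _ => ?_
  simp only [toKronSum]
  split_ifs
  · refine (Finset.card_le_two).trans (by simp)
  · simp

end CNotLayer

/-- Every layer is a sum of Kronecker products whose number of terms is bounded in terms of the
number of multi-line gates. -/
theorem Layer.exists_kronSum {q e N : ℕ} (hq : 2 ≤ q) {S : Set (Matrix.unitaryGroup (Fin 2) ℂ)}
    (U : Layer N) (hU : U.Allowed q S) (he : U.NotMod ∨ q ≤ e + 2) :
    ∃ D : KronSum N e, D.toOp = U.toOp ∧ D.choices.card ≤ (e + 2) ^ (2 * U.multiLine) ∧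
      (D.pairs = CNotLayer.empty N ∨ U = Layer.cnot D.pairs) := by
  cases U with
  | tensor c g =>
    choose M hM using fun i => (g i).exists_terms (e := e) hq (hU i) (he.imp_left fun h => h i)
    refine ⟨KronSum.ofComposition c M, KronSum.toOp_ofComposition c M _ hM, ?_, Or.inl rfl⟩
    refine (KronSum.card_choices_ofComposition c M).trans (Nat.pow_le_pow_right (by omega) ?_)
    simp only [Layer.multiLine]
    omega
  | cnot P => exact ⟨P.toKronSum e, P.toOp_toKronSum e, P.card_choices_toKronSum e, Or.inr rfl⟩

theorem Fin.sum_piFinset_succ {t : ℕ} {X A : Type*} [DecidableEq X] [AddCommMonoid A]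
    (F : Fin (t + 1) → Finset X) (f : (Fin (t + 1) → X) → A) :
    ∑ a ∈ Fintype.piFinset F, f a =
      ∑ b ∈ F 0, ∑ a ∈ Fintype.piFinset fun s : Fin t => F s.succ, f (Fin.cons b a) := by
  rw [← Finset.sum_product']
  symm
  refine Finset.sum_bij' (fun p _ => Fin.cons p.1 p.2) (fun a _ => (a 0, Fin.tail a))
    ?_ ?_ ?_ ?_ ?_
  · intro p hp
    simp only [Finset.mem_product, Fintype.mem_piFinset] at hp
    rw [Fintype.mem_piFinset]
    intro s
    induction s using Fin.cases with
    | zero => exact hp.1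
    | succ s => exact hp.2 s
  · intro a ha
    simp only [Fintype.mem_piFinset, Finset.mem_product] at ha ⊢
    exact ⟨ha 0, fun s => ha s.succ⟩
  · intro p _
    simp
  · intro a _
    simp
  · intro _ _
    rfl

/-! ### Products of layers -/

open Classical in
/-- A composition of sums of Kronecker products, applied to a product state. -/
theorem KronSum.prod_mulVec {N e t : ℕ} (D : Fin t → KronSum N e) (z : Fin N → Fin 2 → ℂ)
    (x : Bits N) :
    (List.ofFn fun s => (D s).toOp).prod.mulVec (productState z) x =
      ∑ a ∈ Fintype.piFinset fun s => (D s).choices.filter (D s).Matched,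
        ∏ i, (List.ofFn fun s => (D s).M i (a s i)).prod.mulVec (z i) (x i) := by
  induction t generalizing x with
  | zero => simp [productState]
  | succ t ih =>
    rw [List.ofFn_succ, List.prod_cons, ← Matrix.mulVec_mulVec, Fin.sum_piFinset_succ]
    simp only [List.ofFn_succ, List.prod_cons, Fin.cons_zero, Fin.cons_succ,
      ← Matrix.mulVec_mulVec]
    rw [Matrix.mulVec, dotProduct]
    simp only [ih (fun s => D s.succ), KronSum.toOp, Finset.sum_mul]
    rw [Finset.sum_comm]
    refine Finset.sum_congr rfl fun b _ => ?_
    simp only [Finset.mul_sum]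
    rw [Finset.sum_comm]
    refine Finset.sum_congr rfl fun a _ => ?_
    simp only [← Finset.prod_mul_distrib]
    have h1 : ∀ (i : Fin N) (v : Fin 2 → ℂ), ((D 0).M i (b i)).mulVec v (x i) =
        ∑ k, (D 0).M i (b i) (x i) k * v k := fun _ _ => rfl
    simp only [h1]
    -- The sum over intermediate basis states factors line by line, turning a product of
    -- matrix–vector sums into a single sum.
    rw [Finset.prod_univ_sum, Fintype.piFinset_univ]

/-! ### The network of a product of layers -/

namespace KronSum

variable {N e t : ℕ} (D : Fin t → KronSum N e)

/-- The colors: one for each controlled-not, named by its layer and target. -/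
abbrev Colors : Type := {c : Fin t × Fin N // (D c.1).pairs.ctrl c.2 ≠ none}

variable {D}

/-- The target of the controlled-not. -/
def Colors.target (c : Colors D) : Fin N := c.1.2

/-- The control of the controlled-not. -/
def Colors.control (c : Colors D) : Fin N :=
  ((D c.1.1).pairs.ctrl c.1.2).get (Option.ne_none_iff_isSome.1 c.2)

theorem Colors.ctrl_target (c : Colors D) :
    (D c.1.1).pairs.ctrl c.target = some c.control := (Option.some_get _).symm

theorem Colors.control_ne_target (c : Colors D) : c.control ≠ c.target := by
  intro h
  have h1 := c.ctrl_target
  have h2 := (D c.1.1).pairs.ctrl_not_target _ _ h1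
  rw [h, h1] at h2
  cases h2

/-- The first line of the controlled-not. -/
def Colors.first (c : Colors D) : Fin N := min c.control c.target

/-- The last line of the controlled-not. -/
def Colors.last (c : Colors D) : Fin N := max c.control c.target

theorem Colors.first_lt_last (c : Colors D) : c.first < c.last :=
  min_lt_max.2 c.control_ne_target

theorem Colors.eq_first_or_eq_last (c : Colors D) (i : Fin N) :
    i = c.first ∨ i = c.last ↔ i = c.control ∨ i = c.target := by
  rcases le_total c.control c.target with h | h <;> simp [first, last, h, or_comm]

/-- Linked neighbours allow the same indices, so an index can be carried over to the next or the
previous position; this provides the required neighbours of every state. -/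
theorem exists_linked {h : ℕ} (D : KronSum N e)
    (H : ∃ i j : Fin N, (i : ℕ) + 1 = j ∧ (j : ℕ) = h ∧ D.link i j) :
    extend D.ok {0} h = extend D.ok {0} (h + 1) := by
  obtain ⟨i, j, h1, rfl, h2⟩ := H
  rw [extend_succ, ← h1, extend_succ, D.ok_link i j h2]

theorem zero_mem_extend (D : KronSum N e) (h : ℕ) : 0 ∈ extend D.ok {0} h := by
  refine (forall_extend D.ok {0} (P := fun _ S => 0 ∈ S)).2 ⟨fun i => D.zero_mem i, ?_, ?_⟩ h <;>
    simp

variable (D)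

open Classical in
/-- The network for a product of layers: a state chooses an index for each layer. -/
def network (z : Fin N → Fin 2 → ℂ) : Network N where
  K := Fin t → Fin (e + 2)
  Color := Colors D
  base := 0
  ok h κ := ∀ s, κ s ∈ extend (D s).ok {0} h
  -- Line `i` sits at position `i + 1`, so positions `h` and `h + 1` are the lines `h - 1` and `h`;
  -- this is the reason for `j = h`.
  rel h κ κ' := ∀ s, (∃ i j : Fin N, (i : ℕ) + 1 = j ∧ (j : ℕ) = h ∧ (D s).link i j) → κ s = κ' s
  amp i κ := (List.ofFn fun s => (D s).M i (κ s)).prod.mulVec (z i)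
  color i κ c := if i = c.first ∨ i = c.last then some (decide (κ c.1.1 = 1)) else none
  ok_zero κ := by simp [funext_iff]
  ok_last κ := by simp [extend_of_lt, funext_iff]
  exists_pred h κ hκ := by
    -- Keep the index in the layers that link the two positions; elsewhere take the index 0, which
    -- is always allowed.
    refine ⟨fun s => if ∃ i j : Fin N, (i : ℕ) + 1 = j ∧ (j : ℕ) = h ∧ (D s).link i j
      then κ s else 0, fun s => ?_, fun s hs => if_pos hs⟩
    dsimp only
    split_ifs with hs
    · rw [exists_linked _ hs]
      exact hκ s
    · exact zero_mem_extend _ _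
  exists_succ h κ hκ := by
    refine ⟨fun s => if ∃ i j : Fin N, (i : ℕ) + 1 = j ∧ (j : ℕ) = h ∧ (D s).link i j
      then κ s else 0, fun s => ?_, fun s hs => (if_pos hs).symm⟩
    dsimp only
    split_ifs with hs
    · rw [← exists_linked _ hs]
      exact hκ s
    · exact zero_mem_extend _ _

variable (z : Fin N → Fin 2 → ℂ)

theorem card_network_K : Fintype.card (network D z).K = (e + 2) ^ t := by
  change Fintype.card (Fin t → Fin (e + 2)) = _
  simp

theorem mem_walks_network {a : Fin N → Fin t → Fin (e + 2)} :
    a ∈ (network D z).walks ↔ ∀ s, (fun i => a i s) ∈ (D s).choices := by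
  classical
  simp only [mem_choices]
  refine (Network.mem_walks _).trans ?_
  have hx : ∀ (i : Fin N) (k : ℕ), (i : ℕ) + 1 = k → ∀ s,
      extend (α := (network D z).K) a (network D z).base k s = a i s := by
    rintro i _ rfl s
    exact congrFun (extend_succ a 0 i) s
  constructor
  · intro H s
    constructor
    · intro i
      have h1 := (H i (Nat.zero_le _) i.2.le).2.1 s
      rw [extend_succ] at h1
      exact hx i _ rfl s ▸ h1
    · intro i j hij hl
      have h1 := (H j (Nat.zero_le _) j.2.le).2.2 s ⟨i, j, hij, rfl, hl⟩
      exact (hx i _ hij s).symm.trans (h1.trans (hx j _ rfl s))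
  · intro H
    have hok : ∀ h, (network D z).ok h (extend a (network D z).base h) := by
      refine (forall_extend a (0 : Fin t → Fin (e + 2)) (P := (network D z).ok)).2
        ⟨fun i s => ?_, fun s => ?_, fun h hh s => ?_⟩
      · rw [extend_succ]
        exact (H s).1 i
      · exact zero_mem_extend _ _
      · exact zero_mem_extend _ _
    intro h _ _
    refine ⟨hok h, hok (h + 1), ?_⟩
    rintro s ⟨i, j, hij, rfl, hl⟩
    exact (hx i _ hij s).trans (((H s).2 i j hij hl).trans (hx j _ rfl s).symm)

/-- Colors cancel amplitudes but remove no paths, so the choices are counted before matching. -/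
theorem card_paths_network :
    (network D z).toGraph.paths.card ≤ ∏ s, (D s).choices.card := by
  rw [Network.card_paths, ← Fintype.card_piFinset]
  refine Finset.card_le_card_of_injOn (fun (a : Fin N → Fin t → Fin (e + 2)) s i => a i s)
    (fun a ha => ?_) fun a _ b _ h => ?_
  · exact Fintype.mem_piFinset.2 ((mem_walks_network D z).1 ha)
  · exact funext fun i => funext fun s => congrFun (congrFun h s) i

theorem color_network_ne_none (i : Fin N) (κ : Fin t → Fin (e + 2)) (c : Colors D) :
    (network D z).color i κ c ≠ none ↔ i = c.first ∨ i = c.last := by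
  by_cases h : i = c.first ∨ i = c.last <;> simp [network, h]

/-- A color only records whether the index is 1. This determines the index, because the two ends of
a pair allow just 0 and 1. -/
theorem matched_iff {a : Fin N → Fin t → Fin (e + 2)} (ha : a ∈ (network D z).walks) :
    (∀ c : Colors D, (network D z).color c.first (a c.first) c =
      (network D z).color c.last (a c.last) c) ↔ ∀ s, (D s).Matched fun i => a i s := by
  have hc : ∀ c : Colors D, (network D z).color c.first (a c.first) c =
      (network D z).color c.last (a c.last) c ↔ a c.control c.1.1 = a c.target c.1.1 := by
    intro c
    have h1 := (mem_choices _).1 ((mem_walks_network D z).1 ha c.1.1)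
    have h2 := h1.1 c.control
    have h3 := h1.1 c.target
    rw [(D c.1.1).ok_control _ _ c.ctrl_target] at h2
    rw [(D c.1.1).ok_target _ _ c.ctrl_target] at h3
    simp only [Finset.mem_insert, Finset.mem_singleton] at h2 h3
    have h4 : (network D z).color c.first (a c.first) c =
        (network D z).color c.last (a c.last) c ↔
        (a c.control c.1.1 = 1 ↔ a c.target c.1.1 = 1) := by
      rcases le_total c.control c.target with h | h <;>
        simp [network, Colors.first, Colors.last, h, iff_comm]
    rw [h4]
    rcases h2 with h2 | h2 <;> rcases h3 with h3 | h3 <;> simp [h2, h3]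
  simp only [hc]
  constructor
  · intro H s i j hij
    have h1 := H ⟨(s, j), by simp [hij]⟩
    simpa [Colors.control, Colors.target, hij] using h1
  · intro H c
    exact H c.1.1 _ _ c.ctrl_target

theorem represents_network : (network D z).toGraph.Represents
    ((List.ofFn fun s => (D s).toOp).prod.mulVec (productState z)) := by
  classical
  intro x
  rw [Network.amplitude_eq_scalar _ Colors.first Colors.last Colors.first_lt_last
    (color_network_ne_none D z), KronSum.prod_mulVec]
  congr 1
  refine Finset.sum_bij (fun (a : Fin N → Fin t → Fin (e + 2)) _ s i => a i s) ?_ ?_ ?_ ?_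
  · intro a ha
    obtain ⟨h1, h2⟩ := Finset.mem_filter.1 ha
    rw [Fintype.mem_piFinset]
    exact fun s => Finset.mem_filter.2
      ⟨(mem_walks_network D z).1 h1 s, (matched_iff D z h1).1 h2 s⟩
  · intro a _ b _ h
    exact funext fun i => funext fun s => congrFun (congrFun h s) i
  · intro b hb
    rw [Fintype.mem_piFinset] at hb
    have h1 : (fun i s => b s i) ∈ (network D z).walks :=
      (mem_walks_network D z).2 fun s => (Finset.mem_filter.1 (hb s)).1
    exact ⟨fun i s => b s i, Finset.mem_filter.2
      ⟨h1, (matched_iff D z h1).2 fun s => (Finset.mem_filter.1 (hb s)).2⟩, rfl⟩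
  · intro a _
    rfl

/-! ### Colors of the network -/

theorem colorLevels_network (c : Colors D) :
    (network D z).toGraph.ColorLevels c c.first c.last := by
  classical
  refine ⟨c.first_lt_last, fun b l => ⟨?_, fun hl => ?_⟩⟩
  · rintro ⟨e, rfl, he⟩
    refine (color_network_ne_none D z _ e.1.2 c).1 fun h => ?_
    have he : (network D z).color e.1.1 e.1.2 c = some b := he
    exact Option.some_ne_none b (he.symm.trans h)
  -- Any value 0 or 1 is allowed in the layer of `c`, and 0 in all other layers, so both the color
  -- and its anticolor occur at either end.
  · let κ : Fin t → Fin (e + 2) := Function.update 0 c.1.1 (if b then 1 else 0)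
    have hκ : (network D z).ok (l + 1) κ := by
      intro s
      rw [extend_succ]
      by_cases hs : s = c.1.1
      · subst hs
        rcases (c.eq_first_or_eq_last l).1 hl with rfl | rfl
        · rw [(D c.1.1).ok_control _ _ c.ctrl_target]
          cases b <;> simp [κ]
        · rw [(D c.1.1).ok_target _ _ c.ctrl_target]
          cases b <;> simp [κ]
      · simpa [κ, hs] using (D s).zero_mem l
    refine ⟨⟨(l, κ), hκ⟩, rfl, ?_⟩
    change (if l = c.first ∨ l = c.last then some (decide (κ c.1.1 = 1)) else none) = some b
    rw [if_pos hl]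
    cases b <;> simp [κ]

theorem appears_network {c : Colors D} {b : Bool} {l : Fin N} :
    (network D z).toGraph.Appears c b l ↔ l = c.control ∨ l = c.target := by
  rw [← c.eq_first_or_eq_last]
  exact (colorLevels_network D z c).2 b l

/-- In each layer a line is the target of at most one pair and the control of at most one, so layer
and role determine the color. -/
theorem colorsAt_network (i : Fin N) : (network D z).toGraph.colorsAt i ≤ t * 2 := by
  classical
  refine (Finset.card_le_card_of_injOn (t := (Finset.univ : Finset (Fin t × Bool)))
    (fun c : (network D z).toGraph.Color =>
      let c : Colors D := c
      (c.1.1, decide (i = c.target))) (fun _ _ => Finset.mem_univ _)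
    ?_).trans (by simp)
  intro c hc c' hc' h
  obtain ⟨b, hb⟩ : ∃ b, (network D z).toGraph.Appears c b i := by simpa using hc
  obtain ⟨b', hb'⟩ : ∃ b, (network D z).toGraph.Appears c' b i := by simpa using hc'
  replace hb := (appears_network D z).1 hb
  replace hb' := (appears_network D z).1 hb'
  simp only [Prod.mk.injEq, decide_eq_decide] at h
  refine Subtype.ext (Prod.ext h.1 ?_)
  by_cases h1 : i = c.target
  · exact h1.symm.trans (h.2.1 h1)
  · have h2 := c.ctrl_target
    have h3 := c'.ctrl_target
    rw [← hb.resolve_right h1, h.1] at h2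
    rw [← hb'.resolve_right fun h4 => h1 (h.2.2 h4)] at h3
    exact (D c'.1.1).pairs.ctrl_inj _ _ _ h2 h3

end KronSum

/-! ### Active colors as controlled-nots across a cut -/

open Classical in
/-- The targets of the controlled-not's between a line up to `l` and a line after `l`. -/
def CNotLayer.crossing {N : ℕ} (P : CNotLayer N) (l : Fin N) : Finset (Fin N) :=
  Finset.univ.filter fun j => ∃ i, P.ctrl j = some i ∧ min i j ≤ l ∧ l < max i j

theorem KronSum.activeAt_network {N e t : ℕ} (D : Fin t → KronSum N e) (z : Fin N → Fin 2 → ℂ)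
    (l : Fin N) :
    (network D z).toGraph.activeAt l ≤ ∑ s, ((D s).pairs.crossing l).card := by
  classical
  rw [← Finset.card_sigma]
  refine Finset.card_le_card_of_injOn (fun c : Colors D => (⟨c.1.1, c.1.2⟩ : (_ : Fin t) × Fin N))
    ?_ ?_
  · intro c hc
    obtain ⟨i, j, h1, h2, h3⟩ : ∃ i j, (network D z).toGraph.ColorLevels c i j ∧ i ≤ l ∧ l < j := by
      simpa [TensorGraph.activeAt] using hc
    have h4 := colorLevels_network D z c
    have h5 : ∀ k, k = i ∨ k = j ↔ k = c.first ∨ k = c.last := fun k =>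
      ((h1.2 true k).symm.trans (h4.2 true k))
    have h6 : c.first ≤ l ∧ l < c.last := by
      have h7 := h1.1
      have h8 := h4.1
      rcases (h5 i).1 (Or.inl rfl) with rfl | rfl
      · rcases (h5 j).1 (Or.inr rfl) with rfl | rfl
        · exact absurd h7 (lt_irrefl _)
        · exact ⟨h2, h3⟩
      · rcases (h5 j).1 (Or.inr rfl) with rfl | rfl
        · exact absurd h7 h8.asymm
        · exact absurd h7 (lt_irrefl _)
    simp only [Finset.coe_sigma, Set.mem_sigma_iff, Finset.mem_coe, Finset.mem_univ, true_and,
      CNotLayer.crossing, Finset.mem_filter]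
    exact ⟨c.control, c.ctrl_target, h6⟩
  · intro c _ c' _ h
    simp only [Sigma.mk.injEq, heq_eq_eq] at h
    exact Subtype.ext (Prod.ext h.1 h.2)

/-! ### The information that a linear map carries across a cut -/

section cut

variable {N : ℕ}

theorem basisMap_mul (f g : Bits N → Bits N) : basisMap f * basisMap g = basisMap (f ∘ g) := by
  funext x y
  simp [basisMap, Matrix.mul_apply]

theorem basisMap_id : basisMap (id : Bits N → Bits N) = 1 := by
  funext x y
  simp [basisMap, Matrix.one_apply]

theorem basisMap_injective : Function.Injective (basisMap : (Bits N → Bits N) → QOp N) := by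
  intro f g h
  funext y
  have h1 : basisMap f (f y) y = basisMap g (f y) y := by rw [h]
  by_contra hne
  simp [basisMap, hne] at h1

/-- The part of `y` on the lines in `L`. -/
def cutTo (L : Finset (Fin N)) (y : Bits N) : Bits N := fun i => if i ∈ L then y i else 0

theorem cutTo_add_cutTo_compl (L : Finset (Fin N)) (y : Bits N) :
    cutTo L y + cutTo Lᶜ y = y := by
  funext i
  by_cases h : i ∈ L <;> simp [cutTo, h]

theorem cutTo_add (L : Finset (Fin N)) (y y' : Bits N) :
    cutTo L (y + y') = cutTo L y + cutTo L y' := by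
  funext i
  by_cases h : i ∈ L <;> simp [cutTo, h]

/-- What the lines in `L` can learn about inputs on the other lines. -/
def flow (L : Finset (Fin N)) (f : Bits N → Bits N) : Finset (Bits N) :=
  Finset.univ.image fun y => cutTo L (f (cutTo Lᶜ y))

/-- By additivity, split `g y` into its parts inside and outside `L`: the inside part ranges over
the flow of `g`, and the outside part contributes an element of the flow of `f`. -/
theorem card_flow_comp_le (L : Finset (Fin N)) {f g : Bits N → Bits N}
    (hf : ∀ y y', f (y + y') = f y + f y') :
    (flow L (f ∘ g)).card ≤ (flow L f).card * (flow L g).card := by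
  refine le_trans (Finset.card_le_card ?_)
    (Finset.card_image₂_le (fun s s' => cutTo L (f s') + s) (flow L f) (flow L g))
  intro v hv
  obtain ⟨y, -, rfl⟩ := Finset.mem_image.1 hv
  refine Finset.mem_image₂.2 ⟨_, Finset.mem_image_of_mem _ (Finset.mem_univ (g (cutTo Lᶜ y))),
    _, Finset.mem_image_of_mem _ (Finset.mem_univ y), ?_⟩
  rw [← cutTo_add, ← hf, cutTo_add_cutTo_compl]
  rfl

theorem exists_prod_eq_basisMap (L : Finset (Fin N)) (l : List (QOp N))
    (hl : ∀ B ∈ l, ∃ f : Bits N → Bits N, B = basisMap f ∧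
      (∀ y y', f (y + y') = f y + f y') ∧ (flow L f).card ≤ 2) :
    ∃ f : Bits N → Bits N, l.prod = basisMap f ∧ (flow L f).card ≤ 2 ^ l.length := by
  induction l with
  | nil =>
    refine ⟨id, basisMap_id.symm, ?_⟩
    have : flow L id ⊆ {0} := by
      intro v hv
      obtain ⟨y, -, rfl⟩ := Finset.mem_image.1 hv
      rw [Finset.mem_singleton]
      funext i
      by_cases h : i ∈ L <;> simp [cutTo, h]
    exact (Finset.card_le_card this).trans (by simp)
  | cons B l ih =>
    obtain ⟨f, rfl, h1, h2⟩ := hl B (by simp)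
    obtain ⟨g, h3, h4⟩ := ih fun B hB => hl B (by simp [hB])
    refine ⟨f ∘ g, by rw [List.prod_cons, h3, basisMap_mul], (card_flow_comp_le L h1).trans ?_⟩
    rw [List.length_cons, pow_succ']
    exact Nat.mul_le_mul h2 h4

/-- Add to every line `j` the line `ctrl j`, if there is one. -/
def addControls (ctrl : Fin N → Option (Fin N)) (y : Bits N) : Bits N :=
  fun j => y j + (ctrl j).elim 0 y

theorem addControls_add (ctrl : Fin N → Option (Fin N)) (y y' : Bits N) :
    addControls ctrl (y + y') = addControls ctrl y + addControls ctrl y' := by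
  funext j
  cases h : ctrl j with
  | none => simp [addControls, h]
  | some i =>
    simp only [addControls, h, Pi.add_apply, Option.elim_some]
    abel

/-- If only `j₀` receives from outside `L`, the output on `L` is supported on that line: one bit. -/
theorem card_flow_addControls_le (L : Finset (Fin N)) (ctrl : Fin N → Option (Fin N)) (j₀ : Fin N)
    (h : ∀ i j, ctrl j = some i → j ∈ L → i ∉ L → j = j₀) :
    (flow L (addControls ctrl)).card ≤ 2 := by
  have : flow L (addControls ctrl) ⊆
      Finset.univ.image fun a : Fin 2 => (Pi.single j₀ a : Bits N) := by
    intro v hv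
    obtain ⟨y, -, rfl⟩ := Finset.mem_image.1 hv
    refine Finset.mem_image.2 ⟨_, Finset.mem_univ (cutTo L (addControls ctrl (cutTo Lᶜ y)) j₀), ?_⟩
    funext j
    by_cases hj : j = j₀
    · subst hj
      simp
    · rw [Pi.single_eq_of_ne hj]
      by_cases hL : j ∈ L
      · cases hc : ctrl j with
        | none => simp [cutTo, addControls, hL, hc]
        | some i =>
          have hi : i ∈ L := by
            by_contra hi
            exact hj (h i j hc hL hi)
          simp [cutTo, addControls, hL, hc, hi]
      · simp [cutTo, hL]
  exact (Finset.card_le_card this).trans (Finset.card_image_le.trans (by simp))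

-- Switching on exactly the controls of a subset `T` of `K` produces on `L` the indicator of `T`, so
-- distinct subsets give distinct outputs. The controls lie outside `L`, so these inputs survive the
-- restriction to the complement.
open Classical in
theorem CNotLayer.pow_card_le_card_flow (P : CNotLayer N) (L K : Finset (Fin N))
    (hK : ∀ j ∈ K, j ∈ L ∧ ∃ i, P.ctrl j = some i ∧ i ∉ L) :
    2 ^ K.card ≤ (flow L (addControls P.ctrl)).card := by
  rw [← Finset.card_powerset]
  refine Finset.card_le_card_of_injOn (fun T j => if j ∈ T then 1 else 0) ?_ ?_
  · intro T hT
    have hT : T ⊆ K := by simpa using hT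
    rw [Finset.mem_coe]
    refine Finset.mem_image.2 ⟨fun i => if ∃ j ∈ T, P.ctrl j = some i then 1 else 0,
      Finset.mem_univ _, ?_⟩
    funext j
    by_cases hj : j ∈ L
    · cases hc : P.ctrl j with
      | none =>
        have hjT : j ∉ T := fun h => by
          obtain ⟨_, i, hi, _⟩ := hK j (hT h)
          rw [hc] at hi
          cases hi
        simp [cutTo, addControls, hj, hc, hjT]
      | some i =>
        have h1 : (∃ j' ∈ T, P.ctrl j' = some i) ↔ j ∈ T :=
          ⟨fun ⟨j', h2, h3⟩ => P.ctrl_inj i j' j h3 hc ▸ h2, fun h2 => ⟨j, h2, hc⟩⟩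
        have h2 : j ∈ T → i ∉ L := fun h => by
          obtain ⟨_, i', hi', h3⟩ := hK j (hT h)
          rw [hc] at hi'
          cases hi'
          exact h3
        simp only [cutTo, addControls, hj, hc, h1, if_true, Finset.mem_compl, not_true,
          if_false, zero_add, Option.elim_some]
        by_cases h3 : j ∈ T <;> simp [h3]
        exact h2 h3
    · have hjT : j ∉ T := fun h => hj (hK j (hT h)).1
      simp [cutTo, hj, hjT]
  · intro T _ T' _ h
    ext j
    have h1 := congrFun h j
    by_cases h2 : j ∈ T <;> by_cases h3 : j ∈ T' <;> simp_all

theorem CNotLayer.toOp_eq_basisMap (P : CNotLayer N) : P.toOp = basisMap (addControls P.ctrl) := by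
  rw [CNotLayer.toOp]
  congr 1
  funext y j
  cases h : P.ctrl j <;> simp [addControls, h]

end cut

/-! ### Spaced controlled-not's -/

namespace SpacedGate

/-- The control of each line. -/
def ctrl : {a : ℕ} → SpacedGate a → Fin a → Option (Fin a)
  | _, ident => fun _ => none
  | _, up m => fun j => if j = 0 then some (Fin.last (m + 1)) else none
  | _, down m => fun j => if j = Fin.last (m + 1) then some 0 else none

theorem toOp_eq_basisMap {a : ℕ} (g : SpacedGate a) : g.toOp = basisMap (addControls g.ctrl) := by
  cases g with
  | ident =>
    rw [toOp, ← basisMap_id]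
    congr 1
    funext y j
    simp [addControls, ctrl]
  | up m =>
    rw [toOp]
    congr 1
    funext y j
    by_cases h : j = 0
    · subst h; simp [addControls, ctrl]
    · simp [addControls, ctrl, h]
  | down m =>
    rw [toOp]
    congr 1
    funext y j
    by_cases h : j = Fin.last (m + 1)
    · subst h; simp [addControls, ctrl]
    · simp [addControls, ctrl, h]

theorem eq_of_ctrl_ne_none {a : ℕ} (g : SpacedGate a) {j j' : Fin a} (h : g.ctrl j ≠ none)
    (h' : g.ctrl j' ≠ none) : j = j' := by
  cases g with
  | ident => exact absurd rfl h
  | up m =>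
    simp only [ctrl, ne_eq, ite_eq_right_iff, reduceCtorEq, imp_false, not_not] at h h'
    rw [h, h']
  | down m =>
    simp only [ctrl, ne_eq, ite_eq_right_iff, reduceCtorEq, imp_false, not_not] at h h'
    rw [h, h']

end SpacedGate

section spaced

variable {N : ℕ} (c : Composition N)

/-- Blocks are intervals of lines. -/
theorem Composition.index_eq_of_between {c : Composition N} {i j l : Fin N}
    (h : c.index i = c.index j) (h1 : min i j ≤ l) (h2 : l < max i j) : c.index l = c.index j := by
  symm
  rw [← Composition.mem_range_embedding_iff', Composition.mem_range_embedding_iff]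
  have hi := c.sizeUpTo_index_le i
  have hj := c.sizeUpTo_index_le j
  have hi' := c.lt_sizeUpTo_index_succ i
  have hj' := c.lt_sizeUpTo_index_succ j
  rw [h] at hi hi'
  rcases le_total i j with hij | hij
  · rw [min_eq_left hij] at h1
    rw [max_eq_right hij] at h2
    exact ⟨hi.trans h1, lt_trans h2 hj'⟩
  · rw [min_eq_right hij] at h1
    rw [max_eq_left hij] at h2
    exact ⟨hj.trans h1, lt_trans h2 hi'⟩

/-- The control of each line in a Kronecker product. -/
def spacedCtrl (g : (i : Fin c.length) → SpacedGate (c.blocksFun i)) (j : Fin N) :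
    Option (Fin N) :=
  ((g (c.index j)).ctrl (c.invEmbedding j)).map (c.embedding (c.index j))

theorem kron_spaced (g : (i : Fin c.length) → SpacedGate (c.blocksFun i)) :
    (kron c fun i => (g i).toOp) = basisMap (addControls (spacedCtrl c g)) := by
  funext x y
  simp only [kron, SpacedGate.toOp_eq_basisMap, basisMap, Finset.prod_ite_zero,
    Finset.prod_const_one, Finset.mem_univ, forall_const]
  congr 1
  rw [eq_iff_iff, funext_iff]
  have h1 : ∀ j, addControls (spacedCtrl c g) y j =
      addControls (g (c.index j)).ctrl (y ∘ c.embedding (c.index j)) (c.invEmbedding j) := by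
    intro j
    simp only [addControls, Function.comp, c.embedding_comp_inv, spacedCtrl]
    cases (g (c.index j)).ctrl (c.invEmbedding j) <;> rfl
  constructor
  · intro H j
    have h2 := congrFun (H (c.index j)) (c.invEmbedding j)
    rw [h1, ← h2, Function.comp, c.embedding_comp_inv]
  · intro H b
    have h2 : ∀ p : Σ b, Fin (c.blocksFun b),
        x (c.embedding p.1 p.2) = addControls (g p.1).ctrl (y ∘ c.embedding p.1) p.2 := by
      intro p
      obtain ⟨j, rfl⟩ := c.blocksFinEquiv.symm.surjective p
      change x (c.embedding (c.index j) (c.invEmbedding j)) =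
        addControls (g (c.index j)).ctrl (y ∘ c.embedding (c.index j)) (c.invEmbedding j)
      rw [c.embedding_comp_inv, H j, h1]
    funext i
    exact h2 ⟨b, i⟩

/-- A gate across the cut after `l` acts on the block of `l`, and a spaced gate has at most one
target. -/
theorem spacedCtrl_crossing (g : (i : Fin c.length) → SpacedGate (c.blocksFun i))
    {i j i' j' l : Fin N} (h : spacedCtrl c g j = some i) (h' : spacedCtrl c g j' = some i')
    (h1 : min i j ≤ l) (h2 : l < max i j) (h1' : min i' j' ≤ l) (h2' : l < max i' j') :
    j = j' := by
  obtain ⟨k, hk, rfl⟩ := Option.map_eq_some_iff.1 h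
  obtain ⟨k', hk', rfl⟩ := Option.map_eq_some_iff.1 h'
  have h3 : c.index j = c.index j' :=
    (Composition.index_eq_of_between (c.index_embedding _ _) h1 h2).symm.trans
      (Composition.index_eq_of_between (c.index_embedding _ _) h1' h2')
  have key : ∀ p p' : Σ b, Fin (c.blocksFun b), p.1 = p'.1 → (g p.1).ctrl p.2 ≠ none →
      (g p'.1).ctrl p'.2 ≠ none → p = p' := by
    rintro ⟨b, p⟩ ⟨b', p'⟩ (rfl : b = b') h4 h5
    exact congrArg (Sigma.mk b) ((g b).eq_of_ctrl_ne_none h4 h5)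
  exact c.blocksFinEquiv.symm.injective (key ⟨c.index j, c.invEmbedding j⟩
    ⟨c.index j', c.invEmbedding j'⟩ h3 (by rw [hk]; simp) (by rw [hk']; simp))

theorem IsSpacedProduct.exists_basisMap {A : QOp N} (hA : IsSpacedProduct A) (l : Fin N)
    (L : Finset (Fin N)) (hL : ∀ i j, j ∈ L → i ∉ L → min i j ≤ l ∧ l < max i j) :
    ∃ f : Bits N → Bits N, A = basisMap f ∧
      (∀ y y', f (y + y') = f y + f y') ∧ (flow L f).card ≤ 2 := by
  obtain ⟨c, g, rfl⟩ := hA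
  refine ⟨_, kron_spaced c g, addControls_add _, ?_⟩
  by_cases h : ∃ i j, spacedCtrl c g j = some i ∧ j ∈ L ∧ i ∉ L
  · obtain ⟨i₀, j₀, h1, h2, h3⟩ := h
    exact card_flow_addControls_le L _ j₀ fun i j h4 h5 h6 => spacedCtrl_crossing c g h4 h1
      (hL _ _ h5 h6).1 (hL _ _ h5 h6).2 (hL _ _ h2 h3).1 (hL _ _ h2 h3).2
  · exact card_flow_addControls_le L _ l fun i j h4 h5 h6 => absurd ⟨i, j, h4, h5, h6⟩ h

/-- Comparing both bounds on the flow gives `2 ^ K.card ≤ 2 ^ d`. A matrix determines its map on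
basis states, so the composed map is that of `P` itself. -/
theorem CNotLayer.card_le_of_hasSpacedDepth {d : ℕ} {P : CNotLayer N}
    (hP : HasSpacedDepth d P.toOp) (l : Fin N) (L K : Finset (Fin N))
    (hL : ∀ i j, j ∈ L → i ∉ L → min i j ≤ l ∧ l < max i j)
    (hK : ∀ j ∈ K, j ∈ L ∧ ∃ i, P.ctrl j = some i ∧ i ∉ L) : K.card ≤ d := by
  obtain ⟨ops, h1, h2, h3⟩ := hP
  obtain ⟨f, h4, h5⟩ := exists_prod_eq_basisMap L ops fun B hB => (h2 B hB).exists_basisMap l L hL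
  rw [h3, P.toOp_eq_basisMap] at h4
  rw [← basisMap_injective h4] at h5
  exact ((Nat.pow_le_pow_iff_right (by norm_num)).1
    ((P.pow_card_le_card_flow L K hK).trans h5)).trans h1

/-- A controlled-not layer of spaced depth `d` has at most `2 * d` controlled-not's across a
cut. -/
theorem CNotLayer.card_crossing_le {d : ℕ} {P : CNotLayer N} (hP : HasSpacedDepth d P.toOp)
    (l : Fin N) : (P.crossing l).card ≤ d + d := by
  classical
  -- Targets before and after the cut are counted separately, since the flow bound concerns one
  -- direction at a time.
  rw [← Finset.card_filter_add_card_filter_not (s := P.crossing l) (fun j => j ≤ l)]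
  refine add_le_add
    (CNotLayer.card_le_of_hasSpacedDepth hP l (Finset.univ.filter fun i => i ≤ l) _ ?_ ?_)
    (CNotLayer.card_le_of_hasSpacedDepth hP l (Finset.univ.filter fun i => ¬ i ≤ l) _ ?_ ?_)
  · intro i j hj hi
    simp only [Finset.mem_filter, Finset.mem_univ, true_and, not_le] at hi hj
    exact ⟨min_le_of_right_le hj, lt_max_of_lt_left hi⟩
  · intro j hj
    simp only [crossing, Finset.mem_filter, Finset.mem_univ, true_and] at hj ⊢
    obtain ⟨⟨i, h1, h2, h3⟩, h4⟩ := hj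
    exact ⟨h4, i, h1, fun h5 => absurd h3 (not_lt.2 (max_le h5 h4))⟩
  · intro i j hj hi
    simp only [Finset.mem_filter, Finset.mem_univ, true_and, not_le, not_lt] at hi hj
    exact ⟨min_le_of_left_le hi, lt_max_of_lt_right hj⟩
  · intro j hj
    simp only [crossing, Finset.mem_filter, Finset.mem_univ, true_and, not_le, not_lt] at hj ⊢
    obtain ⟨⟨i, h1, h2, h3⟩, h4⟩ := hj
    refine ⟨h4, i, h1, ?_⟩
    by_contra h5
    exact absurd h2 (not_le.2 (lt_min (not_le.1 h5) h4))

end spaced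

theorem CNotLayer.card_crossing_empty {N : ℕ} (l : Fin N) :
    ((CNotLayer.empty N).crossing l).card = 0 := by
  simp [crossing, empty]

/-! ### Numerical bounds -/

theorem two_mul_pow_le_pow {d q : ℕ} (hd : 2 ≤ d) (hdq : d ≤ q) (t : ℕ) :
    2 * d ^ t ≤ q ^ 2 ^ (2 * t) := by
  have h1 : t + 1 ≤ 2 ^ (2 * t) :=
    (Nat.lt_two_pow_self (n := t)).trans_le (Nat.pow_le_pow_right (by norm_num) (by omega))
  calc 2 * d ^ t ≤ d * d ^ t := Nat.mul_le_mul_right _ hd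
    _ = d ^ (t + 1) := (pow_succ' d t).symm
    _ ≤ d ^ 2 ^ (2 * t) := Nat.pow_le_pow_right (by omega) h1
    _ ≤ q ^ 2 ^ (2 * t) := Nat.pow_le_pow_left hdq _

/-- The crude bound `d ≤ 2 ^ d` replaces the logarithm of `d` in the exponent; `n + 1` also covers
`n = 0`. -/
theorem pow_log_le (d C n : ℕ) :
    d ^ (2 * (C * (Nat.log 2 n + 1))) ≤ (2 * (n + 1)) ^ (d * (2 * C)) := by
  have h1 : 2 ^ Nat.log 2 n ≤ n + 1 := by
    rcases Nat.eq_zero_or_pos n with rfl | h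
    · simp
    · exact (Nat.pow_log_le_self 2 h.ne').trans (Nat.le_succ n)
  calc d ^ (2 * (C * (Nat.log 2 n + 1))) ≤ (2 ^ d) ^ (2 * (C * (Nat.log 2 n + 1))) :=
        Nat.pow_le_pow_left Nat.lt_two_pow_self.le _
    _ = (2 ^ (Nat.log 2 n + 1)) ^ (d * (2 * C)) := by
        rw [← pow_mul, ← pow_mul]
        congr 1
        ring
    _ ≤ (2 * (n + 1)) ^ (d * (2 * C)) := by
        refine Nat.pow_le_pow_left ?_ _
        rw [pow_succ']
        exact Nat.mul_le_mul_left 2 h1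

end

/-! ### Proof of the main theorem -/

theorem mainTheorem4 (q : ℕ) (hq : 2 ≤ q) (F : CircuitFamily) (hF : F.IsQACC q)
    (z : (n : ℕ) → Fin (F.lines n) → Fin 2 → ℂ) :
    ∃ G : (n : ℕ) → TensorGraph (F.lines n),
      (ColorConsistent G ∧
        (∀ n, (G n).width ≤ q ^ 2 ^ (2 * F.depth n)) ∧
        (F.FanOutForm → ∀ n, (G n).width ≤ 2 ^ 2 ^ (2 * F.depth n)) ∧
        (∃ P : ℕ[X], ∀ n, (G n).size ≤ P.eval n) ∧
        ∀ n, (G n).Represents ((F.toOp n).mulVec (productState (z n)))) ∧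
      (F.LogPlanar → LogColorDepth G) ∧
      (F.LogGates → ∃ P : ℕ[X], ∀ n, (G n).paths.card ≤ P.eval n) := by
  obtain ⟨⟨T, hT⟩, S, -, hS⟩ := hF
  -- The number of indices `e + 2` is 2 in fan-out form and `q` otherwise; this form makes 0 and 1
  -- distinct indices.
  obtain ⟨e, he, heq, hfan⟩ : ∃ e : ℕ, (F.FanOutForm ∨ q ≤ e + 2) ∧ e + 2 ≤ q ∧
      (F.FanOutForm → e + 2 ≤ 2) := by
    by_cases h : F.FanOutForm
    · exact ⟨0, Or.inl h, hq, fun _ => le_rfl⟩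
    · exact ⟨q - 2, Or.inr (by omega), by omega, fun h' => absurd h' h⟩
  have hmem : ∀ n (s : Fin (F.depth n)), (F.layers n).get s ∈ F.layers n :=
    fun n s => List.get_mem _ _
  choose D hD1 hD2 hD3 using fun n (s : Fin (F.depth n)) =>
    Layer.exists_kronSum (e := e) hq ((F.layers n).get s) (hS n _ (hmem n s))
      (he.imp_left fun h => h n _ (hmem n s))
  have hwidth : ∀ n, (KronSum.network (D n) (z n)).toGraph.width ≤ 2 * (e + 2) ^ F.depth n :=
    fun n => (Network.width_le _).trans (by rw [KronSum.card_network_K])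
  refine ⟨fun n => (KronSum.network (D n) (z n)).toGraph, ⟨⟨⟨T * 2, fun n i => ?_⟩,
    fun n c => ⟨_, _, KronSum.colorLevels_network (D n) (z n) c⟩, fun n e₁ e₂ h c => ?_⟩,
    fun n => ?_, fun h n => ?_, ?_, fun n => ?_⟩, ?_, ?_⟩
  · exact (KronSum.colorsAt_network _ _ i).trans (Nat.mul_le_mul_right 2 (hT n))
  · refine not_iff_not.1 ((KronSum.color_network_ne_none (D n) (z n) e₁.1.1 e₁.1.2 c).trans
      (Iff.trans ?_ (KronSum.color_network_ne_none (D n) (z n) e₂.1.1 e₂.1.2 c).symm))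
    have h : e₁.1.1 = e₂.1.1 := h
    rw [h]
  · exact (hwidth n).trans (two_mul_pow_le_pow (by omega) heq _)
  · exact (hwidth n).trans (two_mul_pow_le_pow (by omega) (hfan h) _)
  · let k := (e + 2) ^ T
    refine ⟨(Polynomial.X + F.p + 1) * Polynomial.C (2 * k + k ^ 2 + k), fun n => ?_⟩
    refine (Network.size_le _).trans ?_
    have h1 : (e + 2) ^ F.depth n ≤ k := Nat.pow_le_pow_right (by omega) (hT n)
    rw [KronSum.card_network_K]
    simp only [Polynomial.eval_mul, Polynomial.eval_add, Polynomial.eval_X, Polynomial.eval_one,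
      Polynomial.eval_C]
    gcongr
  · have h1 : F.toOp n = (List.ofFn fun s => (D n s).toOp).prod := by
      rw [CircuitFamily.toOp]
      simp only [hD1]
      congr 1
      conv_lhs => rw [← List.ofFn_get (F.layers n), List.map_ofFn]
      rfl
    rw [h1]
    exact KronSum.represents_network (D n) (z n)
  · rintro ⟨C, hC⟩
    refine ⟨T * (C + C), fun n l => (KronSum.activeAt_network (D n) (z n) l).trans ?_⟩
    have h1 : ∀ s ∈ Finset.univ, ((D n s).pairs.crossing l).card ≤
        C * (Nat.log 2 n + 1) + C * (Nat.log 2 n + 1) := by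
      intro s _
      -- The layer's pairs are either empty, giving no colors, or those of an actual controlled-not
      -- layer, which has logarithmic spaced depth.
      rcases hD3 n s with h | h
      · rw [h, CNotLayer.card_crossing_empty]
        exact Nat.zero_le _
      · exact CNotLayer.card_crossing_le (hC n _ (h ▸ hmem n s)) l
    refine (Finset.sum_le_card_nsmul _ _ _ h1).trans ?_
    rw [Finset.card_univ, Fintype.card_fin, smul_eq_mul, mul_assoc, add_mul]
    exact Nat.mul_le_mul_right _ (hT n)
  · rintro ⟨C, hC⟩
    refine ⟨(2 * (Polynomial.X + 1)) ^ ((e + 2) * (2 * C)), fun n => ?_⟩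
    have h1 : ∑ s : Fin (F.depth n), ((F.layers n).get s).multiLine ≤
        C * (Nat.log 2 n + 1) := by
      refine le_trans (le_of_eq ?_) (hC n)
      conv_rhs => rw [← List.ofFn_get (F.layers n), List.map_ofFn, List.sum_ofFn]
      rfl
    calc (KronSum.network (D n) (z n)).toGraph.paths.card
        ≤ ∏ s, (D n s).choices.card := KronSum.card_paths_network _ _
      _ ≤ ∏ s, (e + 2) ^ (2 * ((F.layers n).get s).multiLine) :=
          Finset.prod_le_prod' fun s _ => hD2 n s
      _ = (e + 2) ^ (2 * ∑ s : Fin (F.depth n), ((F.layers n).get s).multiLine) := by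
          rw [Finset.prod_pow_eq_pow_sum, Finset.mul_sum]
          rfl
      _ ≤ (e + 2) ^ (2 * (C * (Nat.log 2 n + 1))) :=
          Nat.pow_le_pow_right (by omega) (Nat.mul_le_mul_left 2 h1)
      _ ≤ (2 * (n + 1)) ^ ((e + 2) * (2 * C)) := pow_log_le _ _ _
      _ = _ := by simp
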